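/- Let $T$ be a generalized interval exchange transformation on $I=[l,r)$: $I$ is partitioned into nonempty intervals $I_e$ (closed on the left, open on the right) indexed by a finite alphabet $\mathcal A$, $T$ is continuous and strictly increasing on each $I_e$, and the $TI_e$ are intervals of the same kind partitioning $I$. It is standard if $T$ is a translation on each $I_e$. Write $e<_Df$ if $I_e$ lies strictly to the left of $I_f$, and $e<_Af$ if $TI_e$ lies strictly to the left of $TI_f$; $T$ is symmetric if $<_A$ and $<_D$ are reverse orders. Let $L(T)$ be the set of finite words occurring in the codings $(x_n)_{n\in\mathbb Z}$ of the two-sided orbits ($x_n=e$ iff $T^nx\in I_e$). A word of $L(T)$ is bispecial if it has at least two left extensions and at least two right extensions by one letter in $L(T)$. For $v\in L(T)$ let $[v]\subseteq I$ be the set of points whose forward coding begins with $v$. The induced map $T_{[v]}$ exists if every $x\in[v]$ satisfies $T^nx\in[v]$ for some $n>0$; it is then $T_{[v]}x=T^{n(x)}x$, with $n(x)$ the least such $n$. Its defining intervals are indexed by the return words of $v$, i.e. the words $V$ such that $Vv\in L(T)$ contains exactly two occurrences of $v$, one as a prefix and one as a suffix; the defining interval of $V$ is the set of $x\in[v]$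 whose coding $x_0\cdots x_{n(x)-1}$ up to the first return is $V$. As for $T$, the map $T_{[v]}$ is symmetric if the order of its defining intervals and the order of their images under $T_{[v]}$ are reverse to each other. Proposition. Let $T$ be a symmetric generalized interval exchange transformation and let $v\in L(T)$. (1) If $v$ is a palindrome, or if a shortest bispecial word of $L(T)$ containing $v$ exists and is a palindrome, then $T_{[v]}$, if it exists, is symmetric. (2) If moreover $T$ is standard, and a shortest bispecial word of $L(T)$ containing $v$ exists and is not a palindrome, then $T_{[v]}$ exists and is not symmetric. -/

import Mathlib

open Set

/-! ### Words and languages -/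

/-- `w` occurs in `u` at index `i` (indices start from `0`). -/
def OccursAt {A : Type*} (w u : List A) (i : ℕ) : Prop :=
  i + w.length ≤ u.length ∧ (u.drop i).take w.length = w

/-- `w` is a palindrome: it equals its reverse. -/
def IsPalindrome {A : Type*} (w : List A) : Prop := w.reverse = w

/-- `w` has more than one right extension in `L`. -/
def IsRightSpecial {A : Type*} (L : Set (List A)) (w : List A) : Prop :=
  w ∈ L ∧ ∃ a b : A, a ≠ b ∧ w ++ [a] ∈ L ∧ w ++ [b] ∈ L

/-- `w` has more than one left extension in `L`. -/
def IsLeftSpecial {A : Type*} (L : Set (List A)) (w : List A) : Prop :=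
  w ∈ L ∧ ∃ a b : A, a ≠ b ∧ a :: w ∈ L ∧ b :: w ∈ L

def IsBispecial {A : Type*} (L : Set (List A)) (w : List A) : Prop :=
  IsRightSpecial L w ∧ IsLeftSpecial L w

/-- `w` is a bispecial word of `L` containing `v`, of minimal length among those. -/
def IsShortestBispecialContaining {A : Type*} (L : Set (List A)) (v w : List A) : Prop :=
  IsBispecial L w ∧ v <:+: w ∧
    ∀ w' : List A, IsBispecial L w' → v <:+: w' → w.length ≤ w'.length

/-- `V` is a prefix return word of `w` in `L`: the word `Vw` is in `L` and has exactly two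
occurrences of `w`, one as a prefix (index `0`) and one as a suffix (index `|V|`). -/
def IsPrefixReturnWord {A : Type*} (L : Set (List A)) (w V : List A) : Prop :=
  V ≠ [] ∧ V ++ w ∈ L ∧ ∀ i : ℕ, OccursAt w (V ++ w) i ↔ i = 0 ∨ i = V.length

/-! ### The pair of orders of a map given with its defining intervals -/

/-- `e <_D f`: the interval `P e` is strictly to the left of the interval `P f`. -/
def OrderD {ι : Type*} (P : ι → Set ℝ) (e f : ι) : Prop :=
  ∀ x ∈ P e, ∀ y ∈ P f, x < y

/-- `e <_A f`: the image by `T` of the interval `P e` is strictly to the left of the image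
of the interval `P f`. -/
def OrderA {ι : Type*} (T : ℝ → ℝ) (P : ι → Set ℝ) (e f : ι) : Prop :=
  OrderD (fun i => T '' P i) e f

/-- The map `T`, given with its defining intervals `P`, is symmetric: `<_A` and `<_D` are
reverse orders. -/
def SymmetricOrders {ι : Type*} (T : ℝ → ℝ) (P : ι → Set ℝ) : Prop :=
  ∀ e f : ι, OrderA T P e f ↔ OrderD P f e

/-! ### Generalized interval exchange transformations -/

/-- A generalized interval exchange transformation on `[left, right)`, given together with its
defining intervals `[lo e, hi e)`, indexed by the alphabet `A`. The values of `toFun` outside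
`[left, right)` play no role. -/
structure GIET (A : Type*) where
  left : ℝ
  right : ℝ
  left_lt_right : left < right
  lo : A → ℝ
  hi : A → ℝ
  lo_lt_hi : ∀ e, lo e < hi e
  toFun : ℝ → ℝ
  iUnion_piece : ⋃ e, Ico (lo e) (hi e) = Ico left right
  disjoint_piece : ∀ e f, e ≠ f → Disjoint (Ico (lo e) (hi e)) (Ico (lo f) (hi f))
  continuousOn_piece : ∀ e, ContinuousOn toFun (Ico (lo e) (hi e))
  strictMonoOn_piece : ∀ e, StrictMonoOn toFun (Ico (lo e) (hi e))
  image_piece : ∀ e, ∃ c d : ℝ, c < d ∧ toFun '' Ico (lo e) (hi e) = Ico c d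
  iUnion_image : ⋃ e, toFun '' Ico (lo e) (hi e) = Ico left right
  disjoint_image : ∀ e f, e ≠ f →
    Disjoint (toFun '' Ico (lo e) (hi e)) (toFun '' Ico (lo f) (hi f))

namespace GIET

/-- The defining interval `I_e`. -/
def piece {A : Type*} (T : GIET A) (e : A) : Set ℝ := Ico (T.lo e) (T.hi e)

/-- `T` is standard: its restriction to each defining interval is affine of slope `1`. -/
def IsStandard {A : Type*} (T : GIET A) : Prop :=
  ∀ e, ∃ c : ℝ, ∀ x ∈ T.piece e, T.toFun x = x + c

/-- `T` is symmetric. -/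
def IsSymmetric {A : Type*} (T : GIET A) : Prop := SymmetricOrders T.toFun T.piece

/-- `u` is a trajectory of `T`: the coding of a two-sided orbit `z`. -/
def IsTrajectory {A : Type*} (T : GIET A) (u : ℤ → A) : Prop :=
  ∃ z : ℤ → ℝ, ∀ n : ℤ, z (n + 1) = T.toFun (z n) ∧ z n ∈ T.piece (u n)

/-- The natural coding `L(T)`: all finite words occurring in the trajectories. -/
def naturalCoding {A : Type*} (T : GIET A) : Set (List A) :=
  {w | ∃ u : ℤ → A, T.IsTrajectory u ∧ ∃ n : ℤ, ∀ i : Fin w.length, w.get i = u (n + i)}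

/-- The cylinder `[w]`: the points of the interval whose coding starts with `w`. -/
def cylinder {A : Type*} (T : GIET A) (w : List A) : Set ℝ :=
  {x | x ∈ Ico T.left T.right ∧ ∀ i : Fin w.length, T.toFun^[i] x ∈ T.piece (w.get i)}

/-- The induced map on `[w]` exists: every point of `[w]` comes back to `[w]`. -/
def InducedExists {A : Type*} (T : GIET A) (w : List A) : Prop :=
  ∀ x ∈ T.cylinder w, ∃ n : ℕ, 0 < n ∧ T.toFun^[n] x ∈ T.cylinder w

/-- The first return time `n(x)` to `[w]`. -/
noncomputable def returnTime {A : Type*} (T : GIET A) (w : List A) (x : ℝ) : ℕ :=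
  sInf {n : ℕ | 0 < n ∧ T.toFun^[n] x ∈ T.cylinder w}

/-- The induced map `T_[w]`. -/
noncomputable def inducedMap {A : Type*} (T : GIET A) (w : List A) (x : ℝ) : ℝ :=
  T.toFun^[T.returnTime w x] x

/-- The defining interval of `T_[w]` indexed by the return word `V`: the points of `[w]` whose
coding up to the first return to `[w]` is `V`. -/
def inducedPiece {A : Type*} (T : GIET A) (w V : List A) : Set ℝ :=
  {x | x ∈ T.cylinder w ∧ T.returnTime w x = V.length ∧ x ∈ T.cylinder V}

/-- The induced map `T_[w]`, whose defining intervals are indexed by the return words of `w` in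
`L(T)`, is symmetric. -/
def InducedIsSymmetric {A : Type*} (T : GIET A) (w : List A) : Prop :=
  SymmetricOrders (T.inducedMap w)
    (fun V : {V : List A // IsPrefixReturnWord T.naturalCoding w V} => T.inducedPiece w V)

end GIET

/-! ### Palindromes in sequences satisfying the symmetric order condition -/

/-! Order the letters by the left endpoints of their intervals. `T` preserves order inside a piece
and, being symmetric, reverses it between pieces. So two points are compared by the first letter at
which their futures differ and also, with the order reversed, by the nearest letter at which their
pasts differ. Equating the two tests shows that trajectories satisfy `OrderCondition`.

The combinatorial core is `IsMirrorReturn.palOn`: under that condition, a factor leading from a word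
to its reverse, with neither strictly in between, is a palindrome. Hence complete returns to a
palindrome are palindromes, and a non-palindrome alternates with its reverse
(`exists_reverse_between`).

Every occurrence of `v` extends to the shortest bispecial word `w` (`exists_unique_extension`), so
returns to `v` are shifted returns to `w`. If `w` is a palindrome, two complete returns to it first
differ, read forwards or backwards, at the same pair of letters. This pair decides the order of the
pieces, and in the opposite sense that of their images.

If `w` is not a palindrome, an extension `b w.reverse c` lies within a complete return that begins
with `w b` and ends with `c w` (`exists_return_of_mem`). Two extensions with distinct `b`'s and
distinct `c`'s exist, and the order condition on `w.reverse` forces the induced map to preserve the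
order of the two corresponding pieces. This argument needs recurrence, which
`IsStandard.inducedExists` obtains from finiteness of the alphabet and the pigeonhole principle. -/

/-- The symmetric order condition for a sequence over a linearly ordered alphabet: if `x₁ s y₁`
and `x₂ s y₂` occur in `u` and `x₁ < x₂`, then `y₂ ≤ y₁`. -/
def OrderCondition (u : ℤ → ℝ) : Prop :=
  ∀ i j n : ℤ, u (i - 1) < u (j - 1) → (∀ t, 0 ≤ t → t < n → u (i + t) = u (j + t)) →
    0 ≤ n → u (j + n) ≤ u (i + n)

/-- The factor of `u` on `[a, b)` is a palindrome. -/
def PalOn (u : ℤ → ℝ) (a b : ℤ) : Prop := ∀ k, a ≤ k → k < b → u k = u (a + b - 1 - k)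

theorem OrderCondition.neg_seq {u : ℤ → ℝ} (hu : OrderCondition u) :
    OrderCondition (fun k => - u k) := by
  intro i j n h1 h2 hn
  have := hu j i n (by simpa using h1) (fun t h0 ht => by simpa using (h2 t h0 ht).symm) hn
  simpa using this

/-- The contrapositive of the condition exchanges the two ends of the common factor. With
`OrderCondition.neg_seq`, this lets one inequality stand for its mirror images below. -/
theorem OrderCondition.reverse_seq {u : ℤ → ℝ} (hu : OrderCondition u) :
    OrderCondition (fun k => u (-1 - k)) := by
  intro i j n h1 h2 hn
  by_contra hlt
  push Not at hlt
  have e1 : ∀ k : ℤ, -k - n - 1 = -1 - (k + n) := fun k => by ring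
  have e2 : ∀ k : ℤ, -k - n + n = -1 - (k - 1) := fun k => by ring
  have := hu (-i - n) (-j - n) n (by rw [e1, e1]; exact hlt) (fun t h0 ht => by
    have h := h2 (n - 1 - t) (by omega) (by omega)
    have a1 : -1 - (i + (n - 1 - t)) = -i - n + t := by ring
    have a2 : -1 - (j + (n - 1 - t)) = -j - n + t := by ring
    simp only [a1, a2] at h
    exact h) hn
  rw [e2, e2] at this
  exact absurd h1 (not_lt.mpr this)

theorem PalOn.of_eq {u u' : ℤ → ℝ} {a b a' b' : ℤ} (h : PalOn u a b) (hl : b - a = b' - a')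
    (he : ∀ t, 0 ≤ t → t < b - a → u' (a' + t) = u (a + t)) : PalOn u' a' b' := by
  intro k hk hk'
  have h1 := he (k - a') (by omega) (by omega)
  have h2 := he (b' - 1 - k) (by omega) (by omega)
  have h3 := h (a + (k - a')) (by omega) (by omega)
  rw [show a' + (k - a') = k by ring] at h1
  rw [show a' + (b' - 1 - k) = a' + b' - 1 - k by ring] at h2
  rw [h1, h2, h3]
  congr 1
  omega

theorem exists_first_ne {p : ℤ → Prop} {m : ℤ} (h : ¬ ∀ t, 0 ≤ t → t < m → p t) :
    ∃ t, 0 ≤ t ∧ t < m ∧ ¬ p t ∧ ∀ s, 0 ≤ s → s < t → p s := by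
  push Not at h
  obtain ⟨t, h0, h1, h2⟩ := h
  obtain ⟨t, ⟨h0, h1, h2⟩, hmin⟩ := Int.exists_least_of_bdd
    (P := fun t => 0 ≤ t ∧ t < m ∧ ¬ p t) ⟨0, fun z hz => hz.1⟩ ⟨t, h0, h1, h2⟩
  refine ⟨t, h0, h1, h2, fun s hs hst => ?_⟩
  by_contra hp
  have := hmin s ⟨hs, by omega, hp⟩
  omega

/-- Walking along the successive occurrences of the palindromic suffix of length `ρ` of the factor
of length `n` at `a`, the sequence is trapped and never reaches the mirror image of that factor
which ends at `b`. -/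
theorem trapped_of_lt {u : ℤ → ℝ} (hu : OrderCondition u) {a b n ρ : ℤ} (hρ0 : 0 ≤ ρ) (hρn : ρ < n)
    (hn : 2 * n + 2 ≤ b - a) (mir : ∀ t, 0 ≤ t → t < n → u (a + t) = u (b - 1 - t))
    (hpal : PalOn u (a + n - ρ) (a + n))
    (hmax : ∀ σ, ρ < σ → σ < n → ¬ PalOn u (a + n - σ) (a + n))
    (hret : ∀ c c', a < c → c < c' → c' + ρ < b →
      (∀ t, 0 ≤ t → t < ρ → u (c + t) = u (a + n - ρ + t)) →
      (∀ t, 0 ≤ t → t < ρ → u (c' + t) = u (a + n - ρ + t)) →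
      (∀ k, c < k → k < c' → ¬ ∀ t, 0 ≤ t → t < ρ → u (k + t) = u (a + n - ρ + t)) →
      PalOn u c (c' + ρ))
    (hno : ∀ k, a < k → k + n < b → ¬ ∀ t, 0 ≤ t → t < n → u (k + t) = u (a + n - 1 - t))
    (hxy : u (a + n) < u (b - 1 - n))
    (hGF : ∃ t, 0 ≤ t ∧ t < n - ρ ∧ (∀ s, 0 ≤ s → s < t → u (a + n + s) = u (a + n - ρ - 1 - s)) ∧
      u (a + n - ρ - 1 - t) < u (a + n + t)) : False := by
  -- `r` occurs at `k`
  set O : ℤ → Prop := fun k => ∀ t, 0 ≤ t → t < ρ → u (k + t) = u (a + n - ρ + t) with hO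
  have hpal' : ∀ t, 0 ≤ t → t < ρ → u (a + n - ρ + t) = u (a + n - 1 - t) := by
    intro t h0 ht
    rw [hpal _ (by omega) (by omega)]
    congr 1; omega
  have hOm : O (b - n) := by
    intro t h0 ht
    rw [hpal' t h0 ht, show a + n - 1 - t = a + (n - 1 - t) by ring, mir _ (by omega) (by omega)]
    congr 1; omega
  have hGm : ∀ t, 0 ≤ t → t < n - ρ → u (b - n + ρ + t) = u (a + n - ρ - 1 - t) := by
    intro t h0 ht
    rw [show a + n - ρ - 1 - t = a + (n - ρ - 1 - t) by ring, mir _ (by omega) (by omega)]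
    congr 1; omega
  -- Take the last occurrence of `r` before `b - n` whose next letter is at most `u (a + n)` and
  -- whose continuation exceeds, at the first difference, that of `r` at `b - n`. The next
  -- occurrence `c'` will inherit both properties.
  obtain ⟨c, ⟨hc1, hc2, hcO, hcx, t1, ht10, ht1, hteq, htlt⟩, hcmax⟩ := Int.exists_greatest_of_bdd
    (P := fun c => a + n - ρ ≤ c ∧ c < b - n ∧ O c ∧ u (c + ρ) ≤ u (a + n) ∧
      ∃ t, 0 ≤ t ∧ t < n - ρ ∧ (∀ s, 0 ≤ s → s < t → u (c + ρ + s) = u (a + n - ρ - 1 - s)) ∧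
      u (a + n - ρ - 1 - t) < u (c + ρ + t)) ⟨b - n, fun z hz => hz.2.1.le⟩
    ⟨a + n - ρ, le_refl _, by omega, fun t _ _ => rfl, by
      rw [show a + n - ρ + ρ = a + n by ring], by
      rw [show a + n - ρ + ρ = a + n by ring]; exact hGF⟩
  obtain ⟨c', ⟨hcc', hc'O⟩, hc'min⟩ := Int.exists_least_of_bdd
    (P := fun k => c < k ∧ O k) ⟨c, fun z hz => hz.1.le⟩ ⟨b - n, hc2, hOm⟩
  have hc'm : c' ≤ b - n := hc'min _ ⟨hc2, hOm⟩
  have hP : PalOn u c (c' + ρ) := hret c c' (by omega) hcc' (by omega) hcO hc'O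
    (fun k h1 h2 h3 => absurd (hc'min k ⟨h1, h3⟩) (by omega))
  have hPF : ∀ t, 0 ≤ t → t < c' - c → u (c' - 1 - t) = u (c + ρ + t) := by
    intro t h0 ht
    rw [hP (c + ρ + t) (by omega) (by omega)]
    congr 1; omega
  -- By the palindrome, the letter before `c'` is the letter after `r` at `c`; it is too small for
  -- `c'` to be `b - n`.
  have hlast : u (c' - 1) < u (b - n - 1) := by
    have := hPF 0 le_rfl (by omega)
    simp only [sub_zero, add_zero] at this
    rw [this, show b - n - 1 = b - 1 - n by ring]
    exact lt_of_le_of_lt hcx hxy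
  have hc'lt : c' < b - n := by
    rcases hc'm.lt_or_eq with h | h
    · exact h
    · rw [h] at hlast; exact absurd hlast (lt_irrefl _)
  -- Full agreement would be a forbidden occurrence of the reversed prefix. Otherwise `hlast` and
  -- the order condition against `b - n` give the direction of the first difference.
  have hG' : ∃ t, 0 ≤ t ∧ t < n - ρ ∧
      (∀ s, 0 ≤ s → s < t → u (c' + ρ + s) = u (a + n - ρ - 1 - s)) ∧
      u (a + n - ρ - 1 - t) < u (c' + ρ + t) := by
    have hne : ¬ ∀ t, 0 ≤ t → t < n - ρ → u (c' + ρ + t) = u (a + n - ρ - 1 - t) := by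
      intro hall
      refine hno c' (by omega) (by omega) (fun t h0 ht => ?_)
      by_cases htρ : t < ρ
      · rw [hc'O t h0 htρ, hpal' t h0 htρ]
      · have := hall (t - ρ) (by omega) (by omega)
        rw [show c' + ρ + (t - ρ) = c' + t by ring] at this
        rw [this]; congr 1; omega
    obtain ⟨t, h0, ht, hn1, hs⟩ := exists_first_ne hne
    refine ⟨t, h0, ht, hs, lt_of_le_of_ne ?_ (Ne.symm hn1)⟩
    have := hu c' (b - n) (ρ + t) hlast (fun s hs0 hs1 => by
      by_cases hsρ : s < ρ
      · rw [hc'O s hs0 hsρ, hOm s hs0 hsρ]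
      · have e1 := hs (s - ρ) (by omega) (by omega)
        have e2 := hGm (s - ρ) (by omega) (by omega)
        rw [show c' + ρ + (s - ρ) = c' + s by ring] at e1
        rw [show b - n + ρ + (s - ρ) = b - n + s by ring] at e2
        rw [e1, e2]) (by omega)
    rw [← hGm t h0 ht]
    simpa [add_assoc] using this
  -- Otherwise the palindrome on `[c, c' + ρ)` is copied at `b - n`, and its mirror image is a
  -- palindromic suffix of the prefix longer than `r`.
  have ht1L : t1 < c' - c := by
    by_contra hge
    refine hmax (ρ + (c' - c)) (by omega) (by omega) ?_
    have hq : PalOn u (b - n) (b - n + (ρ + (c' - c))) := by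
      refine hP.of_eq (by omega) (fun t h0 ht => ?_)
      by_cases htρ : t < ρ
      · rw [hOm t h0 htρ, hcO t h0 htρ]
      · have e1 := hteq (t - ρ) (by omega) (by omega)
        have e2 := hGm (t - ρ) (by omega) (by omega)
        rw [show c + ρ + (t - ρ) = c + t by ring] at e1
        rw [show b - n + ρ + (t - ρ) = b - n + t by ring] at e2
        rw [e1, e2]
    intro k hk hk'
    have e1 := mir (k - a) (by omega) (by omega)
    have e2 := mir (2 * n - (ρ + (c' - c)) - 1 - (k - a)) (by omega) (by omega)
    have e3 := hq (b - 1 - (k - a)) (by omega) (by omega)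
    rw [show a + (k - a) = k by ring] at e1
    rw [e1, e3, show a + n - (ρ + (c' - c)) + (a + n) - 1 - k
      = a + (2 * n - (ρ + (c' - c)) - 1 - (k - a)) by ring, e2]
    congr 1; omega
  -- Read backwards from `c'`, the palindrome repeats the continuation of `r` at `c`. So the left
  -- contexts of `c'` and `a + n - ρ` first differ at distance `t1`, which bounds the letter on the
  -- right.
  have hx' : u (c' + ρ) ≤ u (a + n) := by
    have := hu (a + n - ρ - t1) (c' - t1) (t1 + ρ) (by
        rw [show a + n - ρ - t1 - 1 = a + n - ρ - 1 - t1 by ring,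
          show c' - t1 - 1 = c' - 1 - t1 by ring, hPF t1 ht10 ht1L]
        exact htlt) (fun s hs0 hs1 => by
      by_cases hst : s < t1
      · have e1 := hPF (t1 - 1 - s) (by omega) (by omega)
        have e2 := hteq (t1 - 1 - s) (by omega) (by omega)
        rw [show c' - 1 - (t1 - 1 - s) = c' - t1 + s by ring] at e1
        rw [show a + n - ρ - 1 - (t1 - 1 - s) = a + n - ρ - t1 + s by ring] at e2
        rw [e1, e2]
      · have e1 := hc'O (s - t1) (by omega) (by omega)
        rw [show c' + (s - t1) = c' - t1 + s by ring] at e1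
        rw [e1]; congr 1; omega) (by omega)
    rw [show c' - t1 + (t1 + ρ) = c' + ρ by ring,
      show a + n - ρ - t1 + (t1 + ρ) = a + n by ring] at this
    exact this
  have := hcmax c' ⟨by omega, hc'lt, hc'O, hx', hG'⟩
  omega

/-- There is a longest palindromic suffix among those of length less than `m`. -/
theorem exists_longest_palOn (u : ℤ → ℝ) (e : ℤ) {m : ℤ} (hm : 0 < m) :
    ∃ ρ, 0 ≤ ρ ∧ ρ < m ∧ PalOn u (e - ρ) e ∧ ∀ σ, ρ < σ → σ < m → ¬ PalOn u (e - σ) e := by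
  obtain ⟨ρ, ⟨h0, h1, h2⟩, hmax⟩ := Int.exists_greatest_of_bdd
    (P := fun ρ => 0 ≤ ρ ∧ ρ < m ∧ PalOn u (e - ρ) e) ⟨m, fun z hz => hz.2.1.le⟩
    ⟨0, le_rfl, hm, fun k h1 h2 => by omega⟩
  exact ⟨ρ, h0, h1, h2, fun σ hσ hσm hp => absurd (hmax σ ⟨by omega, hσm, hp⟩) (by omega)⟩

/-- The factor of `u` on `[a, b)` starts with its prefix `v` of length `ℓ`, ends with the reverse
of `v`, and has no other occurrence of `v` or of its reverse. -/
structure IsMirrorReturn (u : ℤ → ℝ) (a b ℓ : ℤ) : Prop where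
  mirror : ∀ t, 0 ≤ t → t < ℓ → u (a + t) = u (b - 1 - t)
  not_occ : ∀ k, a < k → k + ℓ < b → ¬ ∀ t, 0 ≤ t → t < ℓ → u (k + t) = u (a + t)
  not_occ_reverse : ∀ k, a < k → k + ℓ < b → ¬ ∀ t, 0 ≤ t → t < ℓ → u (k + t) = u (a + ℓ - 1 - t)

theorem IsMirrorReturn.reverse_seq {u : ℤ → ℝ} {a b ℓ : ℤ} (h : IsMirrorReturn u a b ℓ) :
    IsMirrorReturn (fun k => u (-1 - k)) (-b) (-a) ℓ := by
  refine ⟨fun t h0 ht => ?_, fun k h1 h2 h3 => ?_, fun k h1 h2 h3 => ?_⟩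
  · have := h.mirror t h0 ht
    rw [show -1 - (-b + t) = b - 1 - t by ring, ← this]
    congr 1; ring
  · refine h.not_occ_reverse (-k - ℓ) (by omega) (by omega) (fun t h0 ht => ?_)
    have e1 := h3 (ℓ - 1 - t) (by omega) (by omega)
    have e2 := h.mirror (ℓ - 1 - t) (by omega) (by omega)
    rw [show -1 - (k + (ℓ - 1 - t)) = -k - ℓ + t by ring,
      show -1 - (-b + (ℓ - 1 - t)) = b - 1 - (ℓ - 1 - t) by ring, ← e2] at e1
    rw [e1]; congr 1; ring
  · refine h.not_occ (-k - ℓ) (by omega) (by omega) (fun t h0 ht => ?_)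
    have e1 := h3 (ℓ - 1 - t) (by omega) (by omega)
    have e2 := h.mirror t (by omega) (by omega)
    rw [show -1 - (k + (ℓ - 1 - t)) = -k - ℓ + t by ring,
      show -1 - (-b + ℓ - 1 - (ℓ - 1 - t)) = b - 1 - t by ring, ← e2] at e1
    exact e1

theorem IsMirrorReturn.neg_seq {u : ℤ → ℝ} {a b ℓ : ℤ} (h : IsMirrorReturn u a b ℓ) :
    IsMirrorReturn (fun k => - u k) a b ℓ := by
  refine ⟨fun t h0 ht => ?_, fun k h1 h2 h3 => ?_, fun k h1 h2 h3 => ?_⟩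
  · simpa using h.mirror t h0 ht
  · exact h.not_occ k h1 h2 (by simpa using h3)
  · exact h.not_occ_reverse k h1 h2 (by simpa using h3)

/-- Successive occurrences of a palindrome form a mirror return. -/
theorem isMirrorReturn_of_palOn {u : ℤ → ℝ} {c c' s ρ : ℤ} (hpal : PalOn u s (s + ρ))
    (hc : ∀ t, 0 ≤ t → t < ρ → u (c + t) = u (s + t))
    (hc' : ∀ t, 0 ≤ t → t < ρ → u (c' + t) = u (s + t))
    (hno : ∀ k, c < k → k < c' → ¬ ∀ t, 0 ≤ t → t < ρ → u (k + t) = u (s + t)) :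
    IsMirrorReturn u c (c' + ρ) ρ := by
  have hpal' : ∀ t, 0 ≤ t → t < ρ → u (s + (ρ - 1 - t)) = u (s + t) := by
    intro t h0 ht
    rw [hpal _ (by omega) (by omega)]
    congr 1; ring
  refine ⟨fun t h0 ht => ?_, fun k h1 h2 h3 => ?_, fun k h1 h2 h3 => ?_⟩
  · rw [hc t h0 ht, ← hpal' t h0 ht, ← hc' (ρ - 1 - t) (by omega) (by omega)]
    congr 1; ring
  · exact hno k h1 (by omega) (fun t h0 ht => (h3 t h0 ht).trans (hc t h0 ht))
  · refine hno k h1 (by omega) (fun t h0 ht => ?_)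
    rw [h3 t h0 ht, show c + ρ - 1 - t = c + (ρ - 1 - t) by ring, hc _ (by omega) (by omega),
      hpal' t h0 ht]

/-- Let `r` be the longest proper palindromic suffix of the prefix of length `n`. By
`trapped_of_lt`, applied to `u` and to its reversed negation, the contexts of `r` near `a` and near
`b` differ in a prescribed direction on each side. These two directions contradict the order
condition. -/
theorem IsMirrorReturn.not_lt_of_first_mismatch {u : ℤ → ℝ} (hu : OrderCondition u) {a b ℓ n : ℤ}
    (ih : ∀ w : ℤ → ℝ, OrderCondition w → ∀ a' b' ℓ' : ℤ, b' - a' < b - a →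
      IsMirrorReturn w a' b' ℓ' → PalOn w a' b')
    (h : IsMirrorReturn u a b ℓ) (hn0 : 0 < n) (hℓn : ℓ ≤ n) (hn : 2 * n + 2 ≤ b - a)
    (mir : ∀ t, 0 ≤ t → t < n → u (a + t) = u (b - 1 - t)) :
    ¬ u (a + n) < u (b - 1 - n) := by
  obtain ⟨ρ, hρ0, hρn, hpal, hmax⟩ := exists_longest_palOn u (a + n) hn0
  -- Stated for any sequence, to be used on `u` and on `fun k => -u (-1 - k)`: reversal swaps the
  -- two mismatched letters and negation restores their order.
  have key : ∀ w : ℤ → ℝ, OrderCondition w → ∀ a b : ℤ, (∀ a' b' ℓ' : ℤ, b' - a' < b - a →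
      IsMirrorReturn w a' b' ℓ' → PalOn w a' b') →
      IsMirrorReturn w a b ℓ → 2 * n + 2 ≤ b - a →
      (∀ t, 0 ≤ t → t < n → w (a + t) = w (b - 1 - t)) → PalOn w (a + n - ρ) (a + n) →
      (∀ σ, ρ < σ → σ < n → ¬ PalOn w (a + n - σ) (a + n)) → w (a + n) < w (b - 1 - n) →
      ∃ t, 0 ≤ t ∧ t < n - ρ ∧
        (∀ s, 0 ≤ s → s < t → w (a + n + s) = w (a + n - ρ - 1 - s)) ∧
        w (a + n + t) < w (a + n - ρ - 1 - t) := by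
    intro w hw a b ih h hn mir hpal hmax hlt
    have hpal' : ∀ t, 0 ≤ t → t < ρ → w (a + n - ρ + t) = w (a + n - 1 - t) := by
      intro t h0 ht
      rw [hpal _ (by omega) (by omega)]
      congr 1; ring
    have hno : ∀ k, a < k → k + n < b →
        ¬ ∀ t, 0 ≤ t → t < n → w (k + t) = w (a + n - 1 - t) := by
      intro k h1 h2 h3
      refine h.not_occ_reverse (k + n - ℓ) (by omega) (by omega) (fun t h0 ht => ?_)
      have := h3 (n - ℓ + t) (by omega) (by omega)
      rw [show k + n - ℓ + t = k + (n - ℓ + t) by ring, this]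
      congr 1; ring
    have hne : ¬ ∀ t, 0 ≤ t → t < n - ρ → w (a + n + t) = w (a + n - ρ - 1 - t) := by
      intro hall
      refine hno (a + n - ρ) (by omega) (by omega) (fun t h0 ht => ?_)
      by_cases htρ : t < ρ
      · exact hpal' t h0 htρ
      · have := hall (t - ρ) (by omega) (by omega)
        rw [show a + n + (t - ρ) = a + n - ρ + t by ring] at this
        rw [this]; congr 1; ring
    obtain ⟨t, h0, ht, hnt, hs⟩ := exists_first_ne hne
    refine ⟨t, h0, ht, hs, lt_of_le_of_ne (not_lt.mp fun hgt => ?_) hnt⟩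
    refine trapped_of_lt hw hρ0 hρn hn mir hpal hmax ?_ hno hlt ⟨t, h0, ht, hs, hgt⟩
    intro c c' hc hcc hc' o1 o2 o3
    refine ih _ _ ρ (by omega) (isMirrorReturn_of_palOn (s := a + n - ρ) ?_ o1 o2 o3)
    rwa [show a + n - ρ + ρ = a + n by ring]
  intro hlt
  obtain ⟨t, ht0, ht, hteq, htlt⟩ := key u hu a b (ih u hu) h hn mir hpal hmax hlt
  -- the suffix of length `σ` of the prefix, and its mirror image
  have hmirpal : ∀ σ, 0 ≤ σ → σ ≤ n → (PalOn (fun k => -u (-1 - k)) (-b + n - σ) (-b + n) ↔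
      PalOn u (a + n - σ) (a + n)) := by
    intro σ h0 hσ
    have e : ∀ s, 0 ≤ s → s < σ → u (-1 - (-b + n - σ + s)) = u (a + n - σ + s) := by
      intro s hs0 hs
      have := mir (n - σ + s) (by omega) (by omega)
      rw [show a + n - σ + s = a + (n - σ + s) by ring, this]
      congr 1; ring
    constructor
    · intro hp
      have hp' : PalOn (fun k => u (-1 - k)) (-b + n - σ) (-b + n) := by
        intro k h1 h2
        have := hp k h1 h2
        simpa using this
      exact hp'.of_eq (by ring) (fun s hs0 hs => (e s hs0 (by omega)).symm)
    · intro hp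
      have hp' : PalOn (fun k => u (-1 - k)) (-b + n - σ) (-b + n) :=
        hp.of_eq (by ring) (fun s hs0 hs => e s hs0 (by omega))
      intro k h1 h2
      have := hp' k h1 h2
      simpa using this
  obtain ⟨t', ht0', ht', hteq', htlt'⟩ := key (fun k => - u (-1 - k))
    (hu.reverse_seq.neg_seq) (-b) (-a)
    (fun a' b' ℓ' hl hr => ih _ hu.reverse_seq.neg_seq a' b' ℓ' (by omega) hr)
    h.reverse_seq.neg_seq (by omega)
    (fun s hs0 hs => by
      have := mir s hs0 hs
      simp only [neg_inj]
      rw [show -1 - (-b + s) = b - 1 - s by ring, ← this]; congr 1; ring)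
    ((hmirpal ρ hρ0 hρn.le).mpr hpal)
    (fun σ h1 h2 h3 => hmax σ h1 h2 ((hmirpal σ (by omega) h2.le).mp h3))
    (by
      simp only [neg_lt_neg_iff]
      rw [show -1 - (-a - 1 - n) = a + n by ring, show -1 - (-b + n) = b - 1 - n by ring]
      exact hlt)
  simp only [neg_lt_neg_iff, neg_inj] at htlt' hteq'
  have hGm : ∀ t, 0 ≤ t → t < n - ρ → u (b - n + ρ + t) = u (a + n - ρ - 1 - t) := by
    intro t h0 ht
    rw [show a + n - ρ - 1 - t = a + (n - ρ - 1 - t) by ring, mir _ (by omega) (by omega)]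
    congr 1; ring
  have hP : ∀ s, 0 ≤ s → s < n - ρ → u (-1 - (-b + n - ρ - 1 - s)) = u (a + n - ρ - 1 - s) := by
    intro s h0 hs
    rw [← hGm s h0 hs]; congr 1; ring
  have hrm : ∀ t, 0 ≤ t → t < ρ → u (b - n + t) = u (a + n - ρ + t) := by
    intro s h0 hs
    rw [hpal (a + n - ρ + s) (by omega) (by omega), show a + n - ρ + (a + n) - 1 - (a + n - ρ + s)
      = a + (n - 1 - s) by ring, mir _ (by omega) (by omega)]
    congr 1; ring
  -- The common factor is `r` extended by `t'` letters to the left and `t` to the right; its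
  -- bordering letters are ordered the same way on both sides.
  have := hu (a + n - ρ - t') (b - n - t') (t' + ρ + t)
    (by
      rw [show a + n - ρ - t' - 1 = a + n - ρ - 1 - t' by ring, ← hP t' ht0' ht',
        show b - n - t' - 1 = -1 - (-b + n + t') by ring]
      exact htlt')
    (fun s hs0 hs => by
      by_cases h1 : s < t'
      · have e1 := hteq' (t' - 1 - s) (by omega) (by omega)
        rw [hP _ (by omega) (by omega)] at e1
        rw [show a + n - ρ - t' + s = a + n - ρ - 1 - (t' - 1 - s) by ring, ← e1]
        congr 1; ring
      · by_cases h2 : s < t' + ρ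
        · have e1 := hrm (s - t') (by omega) (by omega)
          rw [show b - n - t' + s = b - n + (s - t') by ring, e1]
          congr 1; ring
        · have e1 := hteq (s - t' - ρ) (by omega) (by omega)
          rw [← hGm _ (by omega) (by omega)] at e1
          rw [show a + n - ρ - t' + s = a + n + (s - t' - ρ) by ring, e1]
          congr 1; ring)
    (by omega)
  rw [show b - n - t' + (t' + ρ + t) = b - n + ρ + t by ring, hGm t ht0 ht,
    show a + n - ρ - t' + (t' + ρ + t) = a + n + t by ring] at this
  exact absurd htlt (not_lt.mpr this)

/-- In a sequence satisfying the symmetric order condition, mirror returns are palindromes. -/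
theorem IsMirrorReturn.palOn {u : ℤ → ℝ} (hu : OrderCondition u) {a b ℓ : ℤ}
    (h : IsMirrorReturn u a b ℓ) : PalOn u a b := by
  -- The induction on length ranges over all sequences, since shorter instances are also needed in
  -- reversed and negated ones.
  have main : ∀ N : ℕ, ∀ w : ℤ → ℝ, OrderCondition w → ∀ a b ℓ : ℤ, b - a < N →
      IsMirrorReturn w a b ℓ → PalOn w a b := by
    intro N
    induction N with
    | zero => intro w _ a b ℓ hN _ k h1 h2; simp at hN; omega
    | succ N ih =>
      intro w hw a b ℓ hN h
      by_contra hnp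
      have hne : ¬ ∀ t, 0 ≤ t → t < b - a → w (a + t) = w (b - 1 - t) := by
        intro hall
        refine hnp (fun k h1 h2 => ?_)
        have := hall (k - a) (by omega) (by omega)
        rw [show a + (k - a) = k by ring] at this
        rw [this]; congr 1; ring
      obtain ⟨n, hn0, hn1, hn2, hmir⟩ := exists_first_ne hne
      have hℓn : ℓ ≤ n := by
        by_contra hlt
        exact hn2 (h.mirror n hn0 (by omega))
      -- The first mismatch lies in the left half: otherwise its mirror position would be an earlier
      -- one.
      have hnn : 2 * n + 2 ≤ b - a := by
        by_contra hlt
        by_cases heq : n = b - a - 1 - n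
        · exact hn2 (by congr 1; omega)
        · have := hmir (b - a - 1 - n) (by omega) (by omega)
          rw [show a + (b - a - 1 - n) = b - 1 - n by ring,
            show b - 1 - (b - a - 1 - n) = a + n by ring] at this
          exact hn2 this.symm
      -- If `n = 0` then `ℓ ≤ 0`, and the empty word occurs strictly inside.
      have hpos : 0 < n := by
        by_contra hle
        exact h.not_occ (a + 1) (by omega) (by omega) (fun t h1 h2 => by omega)
      push_cast at hN
      rcases lt_or_gt_of_ne hn2 with hlt | hlt
      · exact h.not_lt_of_first_mismatch hw
          (fun w hw a' b' ℓ' hl hr => ih w hw a' b' ℓ' (by omega) hr) hpos hℓn hnn hmir hlt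
      · refine h.reverse_seq.not_lt_of_first_mismatch (n := n) hw.reverse_seq
          (fun w hw a' b' ℓ' hl hr => ih w hw a' b' ℓ' (by omega) hr) hpos hℓn (by omega)
          (fun s hs0 hs => ?_) ?_
        · have := hmir s hs0 hs
          rw [show -1 - (-b + s) = b - 1 - s by ring, ← this]; congr 1; ring
        · rw [show -1 - (-a - 1 - n) = a + n by ring, show -1 - (-b + n) = b - 1 - n by ring]
          exact hlt
  exact main ((b - a + 1).toNat) u hu a b ℓ (by omega) h

/-- Between two occurrences of a word which is not a palindrome, there is an occurrence of its
reverse. -/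
theorem exists_reverse_between {u : ℤ → ℝ} (hu : OrderCondition u) {a e n : ℤ} (hae : a < e)
    (hocc : ∀ t, 0 ≤ t → t < n → u (e + t) = u (a + t)) (hnp : ¬ PalOn u a (a + n)) :
    ∃ c, a < c ∧ c < e ∧ ∀ t, 0 ≤ t → t < n → u (c + t) = u (a + n - 1 - t) := by
  have hn0 : 0 < n := by
    by_contra hle
    exact hnp (fun k h1 h2 => by omega)
  have hnp' : ¬ PalOn u e (e + n) := fun hp =>
    hnp (hp.of_eq (by ring) (fun t h0 ht => (hocc t h0 (by omega)).symm))
  obtain ⟨ρ, hρ0, hρn, hpal, hmax⟩ := exists_longest_palOn u (e + n) hn0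
  -- Take the previous occurrence of the longest proper palindromic suffix; the copy of the word at
  -- `a` provides one. The factor on `[c, e + n)` is then a palindrome. Maximality of `ρ` excludes
  -- `c > e`, non-palindromicity excludes `c = e`, and the palindrome, which ends with the word,
  -- starts with its reverse.
  obtain ⟨c, ⟨hc1, hc2, hcO⟩, hcmax⟩ := Int.exists_greatest_of_bdd
    (P := fun c => a + n - ρ ≤ c ∧ c < e + n - ρ ∧
      ∀ t, 0 ≤ t → t < ρ → u (c + t) = u (e + n - ρ + t)) ⟨e + n, fun z hz => by omega⟩
    ⟨a + n - ρ, le_rfl, by omega, fun t h0 ht => by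
      have := hocc (n - ρ + t) (by omega) (by omega)
      rw [show e + n - ρ + t = e + (n - ρ + t) by ring, this]; congr 1; ring⟩
  have hP : PalOn u c (e + n - ρ + ρ) := by
    refine (isMirrorReturn_of_palOn (s := e + n - ρ) ?_ hcO (fun t _ _ => rfl) ?_).palOn hu
    · rwa [show e + n - ρ + ρ = e + n by ring]
    · intro k h1 h2 h3
      have := hcmax k ⟨by omega, h2, h3⟩
      omega
  rw [show e + n - ρ + ρ = e + n by ring] at hP
  have hce : c ≤ e := by
    by_contra hlt
    refine hmax (e + n - c) (by omega) (by omega) ?_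
    rwa [show e + n - (e + n - c) = c by ring]
  have hcne : c ≠ e := fun h => hnp' (h ▸ hP)
  refine ⟨c, by omega, by omega, fun t h0 ht => ?_⟩
  have := hocc (n - 1 - t) (by omega) (by omega)
  rw [hP _ (by omega) (by omega), show a + n - 1 - t = a + (n - 1 - t) by ring, ← this]
  congr 1; ring

/-! ### Occurrences of words in bi-infinite sequences -/

/-- The word `w` occurs in the sequence `u` at position `i`. -/
def Occ {A : Type*} (u : ℤ → A) (w : List A) (i : ℤ) : Prop :=
  ∀ (k : ℕ) (hk : k < w.length), u (i + k) = w[k]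

theorem occ_nil {A : Type*} (u : ℤ → A) (i : ℤ) : Occ u [] i := fun k hk => by simp at hk

theorem occ_cons {A : Type*} {u : ℤ → A} {a : A} {w : List A} {i : ℤ} :
    Occ u (a :: w) i ↔ u i = a ∧ Occ u w (i + 1) := by
  constructor
  · intro h
    have h0 : u (i + (0 : ℕ)) = a := h 0 (by simp)
    refine ⟨by simpa using h0, fun k hk => ?_⟩
    have := h (k + 1) (by simpa using hk)
    rw [List.getElem_cons_succ] at this
    rw [← this]; congr 1; push_cast; ring
  · rintro ⟨h1, h2⟩ k hk
    cases k with
    | zero => simpa using h1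
    | succ k =>
      have := h2 k (by simpa using hk)
      rw [List.getElem_cons_succ, ← this]; congr 1; push_cast; ring

theorem occ_append {A : Type*} {u : ℤ → A} {s t : List A} {i : ℤ} :
    Occ u (s ++ t) i ↔ Occ u s i ∧ Occ u t (i + s.length) := by
  induction s generalizing i with
  | nil => simp [occ_nil]
  | cons a s ih =>
    rw [List.cons_append, occ_cons, occ_cons, ih, and_assoc]
    have : i + 1 + (s.length : ℤ) = i + ((a :: s).length : ℤ) := by
      rw [List.length_cons]; push_cast; ring
    rw [this]

theorem occ_singleton {A : Type*} {u : ℤ → A} {a : A} {i : ℤ} : Occ u [a] i ↔ u i = a := by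
  rw [occ_cons]; exact ⟨fun h => h.1, fun h => ⟨h, occ_nil _ _⟩⟩

theorem Occ.eq_of_length_eq {A : Type*} {u : ℤ → A} {s t : List A} {i : ℤ} (hs : Occ u s i)
    (ht : Occ u t i) (h : s.length = t.length) : s = t :=
  List.ext_getElem h fun k h1 h2 => by rw [← hs k h1, ← ht k h2]

theorem Occ.agree {A : Type*} {u u' : ℤ → A} {s : List A} {i j : ℤ} (hs : Occ u s i)
    (ht : Occ u' s j) {t : ℤ} (h0 : 0 ≤ t) (h1 : t < s.length) : u (i + t) = u' (j + t) := by
  lift t to ℕ using h0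
  rw [hs t (by omega), ht t (by omega)]

theorem Occ.of_agree {A : Type*} {u u' : ℤ → A} {s : List A} {i j : ℤ} (hs : Occ u s i)
    (h : ∀ t : ℤ, 0 ≤ t → t < s.length → u' (j + t) = u (i + t)) : Occ u' s j := by
  intro k hk
  rw [h k (by omega) (by omega), hs k hk]

/-- The word of length `n` which occurs in `u` at `i`. -/
def seqFactor {A : Type*} (u : ℤ → A) (i : ℤ) (n : ℕ) : List A := List.ofFn fun k : Fin n => u (i + k)

theorem length_seqFactor {A : Type*} (u : ℤ → A) (i : ℤ) (n : ℕ) : (seqFactor u i n).length = n := by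
  simp [seqFactor]

theorem occ_seqFactor {A : Type*} (u : ℤ → A) (i : ℤ) (n : ℕ) : Occ u (seqFactor u i n) i := by
  intro k hk
  simp [seqFactor]

theorem Occ.occursAt_iff {A : Type*} {u : ℤ → A} {w s : List A} {j : ℤ} (hs : Occ u s j) (i : ℕ) :
    OccursAt w s i ↔ i + w.length ≤ s.length ∧ Occ u w (j + i) := by
  unfold OccursAt
  refine and_congr_right fun hl => ?_
  have hocc : Occ u ((s.drop i).take w.length) (j + i) := by
    intro k hk
    have hk' : k < w.length := by simp at hk; omega
    simp only [List.getElem_take, List.getElem_drop]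
    rw [← hs (i + k) (by omega)]
    congr 1; push_cast; ring
  have hlen : ((s.drop i).take w.length).length = w.length := by simp; omega
  constructor
  · intro h; rwa [h] at hocc
  · intro h; exact hocc.eq_of_length_eq h hlen

namespace GIET

variable {A : Type*} (T : GIET A)

/-! ### Orbits -/

/-- `z` is a two-sided orbit of `T`, coded by `u`. -/
def IsOrbit (z : ℤ → ℝ) (u : ℤ → A) : Prop :=
  ∀ n : ℤ, z (n + 1) = T.toFun (z n) ∧ z n ∈ T.piece (u n)

theorem piece_subset (e : A) : T.piece e ⊆ Ico T.left T.right := by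
  rw [← T.iUnion_piece]; exact subset_iUnion (fun e => Ico (T.lo e) (T.hi e)) e

theorem exists_mem_piece {x : ℝ} (hx : x ∈ Ico T.left T.right) : ∃ e, x ∈ T.piece e := by
  rw [← T.iUnion_piece] at hx
  simpa [piece] using hx

theorem eq_of_mem_piece {x : ℝ} {e f : A} (he : x ∈ T.piece e) (hf : x ∈ T.piece f) : e = f := by
  by_contra h
  exact (disjoint_left.mp (T.disjoint_piece e f h)) he hf

theorem bijOn : BijOn T.toFun (Ico T.left T.right) (Ico T.left T.right) := by
  refine ⟨fun x hx => ?_, fun x hx y hy hxy => ?_, fun y hy => ?_⟩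
  · obtain ⟨e, he⟩ := T.exists_mem_piece hx
    rw [← T.iUnion_image]
    exact mem_iUnion_of_mem e ⟨x, he, rfl⟩
  · obtain ⟨e, he⟩ := T.exists_mem_piece hx
    obtain ⟨f, hf⟩ := T.exists_mem_piece hy
    by_cases hef : e = f
    · subst hef
      exact (T.strictMonoOn_piece e).injOn he hf hxy
    · exact absurd (hxy ▸ ⟨y, hf, rfl⟩ : T.toFun x ∈ T.toFun '' Ico (T.lo f) (T.hi f))
        (disjoint_left.mp (T.disjoint_image e f hef) ⟨x, he, rfl⟩)
  · rw [← T.iUnion_image] at hy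
    obtain ⟨e, x, hx, rfl⟩ := mem_iUnion.mp hy
    exact ⟨x, T.piece_subset e hx, rfl⟩

/-- `T` is a bijection of its interval, so integer powers of that permutation supply a past as well
as a future. -/
theorem exists_orbit {x : ℝ} (hx : x ∈ Ico T.left T.right) :
    ∃ z u, T.IsOrbit z u ∧ z 0 = x := by
  set E : Equiv.Perm (Ico T.left T.right) := T.bijOn.equiv
  have hz : ∀ n : ℤ, ∃ e, (((E ^ n) ⟨x, hx⟩ : Ico T.left T.right) : ℝ) ∈ T.piece e :=
    fun n => T.exists_mem_piece ((E ^ n) ⟨x, hx⟩).2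
  choose u hu using hz
  refine ⟨fun n => ((E ^ n) ⟨x, hx⟩ : Ico T.left T.right), u, fun n => ⟨?_, hu n⟩, by simp⟩
  simp only
  rw [add_comm, zpow_one_add, Equiv.Perm.mul_apply]
  rfl

variable {T}

theorem IsOrbit.shift {z : ℤ → ℝ} {u : ℤ → A} (h : T.IsOrbit z u) (m : ℤ) :
    T.IsOrbit (fun n => z (m + n)) (fun n => u (m + n)) := by
  intro n
  have := h (m + n)
  rw [add_assoc] at this
  exact this

theorem IsOrbit.mem_Ico {z : ℤ → ℝ} {u : ℤ → A} (h : T.IsOrbit z u) (i : ℤ) :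
    z i ∈ Ico T.left T.right := T.piece_subset _ (h i).2

theorem IsOrbit.iterate {z : ℤ → ℝ} {u : ℤ → A} (h : T.IsOrbit z u) (i : ℤ) (n : ℕ) :
    T.toFun^[n] (z i) = z (i + n) := by
  induction n with
  | zero => simp
  | succ n ih =>
    rw [Function.iterate_succ_apply', ih, ← (h _).1]; congr 1; push_cast; ring

theorem IsOrbit.mem_cylinder_iff {z : ℤ → ℝ} {u : ℤ → A} (h : T.IsOrbit z u) {i : ℤ} {w : List A} :
    z i ∈ T.cylinder w ↔ Occ u w i := by
  constructor
  · rintro ⟨_, hw⟩ k hk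
    have := hw ⟨k, hk⟩
    rw [h.iterate] at this
    exact T.eq_of_mem_piece (h _).2 this
  · intro ho
    refine ⟨h.mem_Ico i, fun k => ?_⟩
    rw [h.iterate, List.get_eq_getElem, ← ho k k.2]
    exact (h _).2

theorem mem_naturalCoding_iff {w : List A} :
    w ∈ T.naturalCoding ↔ ∃ z u, T.IsOrbit z u ∧ Occ u w 0 := by
  constructor
  · rintro ⟨u, ⟨z, hz⟩, n, hn⟩
    refine ⟨_, _, IsOrbit.shift hz n, fun k hk => ?_⟩
    have := hn ⟨k, hk⟩
    simp only [List.get_eq_getElem] at this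
    rw [this]
    simp
  · rintro ⟨z, u, hz, ho⟩
    refine ⟨u, ⟨z, hz⟩, 0, fun k => ?_⟩
    exact (ho k k.2).symm

theorem IsOrbit.mem_naturalCoding {z : ℤ → ℝ} {u : ℤ → A} (h : T.IsOrbit z u) {i : ℤ} {w : List A}
    (ho : Occ u w i) : w ∈ T.naturalCoding :=
  mem_naturalCoding_iff.mpr ⟨_, _, h.shift i, fun k hk => by rw [← ho k hk]; simp⟩

/-! ### Orders of points in terms of codings -/

theorem lo_injective : Function.Injective T.lo := by
  intro e f h
  refine T.eq_of_mem_piece (x := T.lo e) (left_mem_Ico.mpr (T.lo_lt_hi e)) ?_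
  rw [h]
  exact left_mem_Ico.mpr (T.lo_lt_hi f)

theorem hi_le_lo {e f : A} (h : T.lo e < T.lo f) : T.hi e ≤ T.lo f := by
  by_contra hlt
  push Not at hlt
  have := T.eq_of_mem_piece (x := T.lo f) (e := e) (f := f) ⟨h.le, hlt⟩
    (left_mem_Ico.mpr (T.lo_lt_hi f))
  rw [this] at h
  exact lt_irrefl _ h

theorem lt_of_lo_lt {e f : A} {x y : ℝ} (hx : x ∈ T.piece e) (hy : y ∈ T.piece f)
    (h : T.lo e < T.lo f) : x < y :=
  hx.2.trans_le ((hi_le_lo h).trans hy.1)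

theorem lt_iff_lo_lt {e f : A} {x y : ℝ} (hef : e ≠ f) (hx : x ∈ T.piece e) (hy : y ∈ T.piece f) :
    x < y ↔ T.lo e < T.lo f := by
  refine ⟨fun hxy => ?_, lt_of_lo_lt hx hy⟩
  rcases lt_or_gt_of_ne (T.lo_injective.ne hef) with h | h
  · exact h
  · exact absurd hxy (lt_of_lo_lt hy hx h).not_gt

theorem IsSymmetric.toFun_lt_of_lo_lt (hT : T.IsSymmetric) {e f : A} {x y : ℝ} (hx : x ∈ T.piece e)
    (hy : y ∈ T.piece f) (h : T.lo e < T.lo f) : T.toFun y < T.toFun x :=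
  (hT f e).mpr (fun _ ha _ hb => lt_of_lo_lt ha hb h) _ ⟨y, hy, rfl⟩ _ ⟨x, hx, rfl⟩

theorem IsSymmetric.toFun_lt_iff (hT : T.IsSymmetric) {e f : A} {x y : ℝ} (hef : e ≠ f)
    (hx : x ∈ T.piece e) (hy : y ∈ T.piece f) : T.toFun x < T.toFun y ↔ T.lo f < T.lo e := by
  refine ⟨fun hxy => ?_, hT.toFun_lt_of_lo_lt hy hx⟩
  rcases lt_or_gt_of_ne (T.lo_injective.ne hef) with h | h
  · exact absurd hxy (hT.toFun_lt_of_lo_lt hx hy h).not_gt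
  · exact h

variable {z z' : ℤ → ℝ} {u u' : ℤ → A}

/-- While the codings agree, both points lie in the same piece, on which `T` is increasing. -/
theorem IsOrbit.lt_iff_of_agree (h : T.IsOrbit z u) (h' : T.IsOrbit z' u') {i j : ℤ} {m : ℕ}
    (ha : ∀ t : ℤ, 0 ≤ t → t < m → u (i + t) = u' (j + t)) :
    z i < z' j ↔ z (i + m) < z' (j + m) := by
  induction m with
  | zero => simp
  | succ m ih =>
    rw [ih (fun t h0 ht => ha t h0 (by push_cast; omega))]
    have hu := ha m (by omega) (by push_cast; omega)
    push_cast
    rw [← add_assoc, ← add_assoc, (h _).1, (h' _).1]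
    exact ((T.strictMonoOn_piece _).lt_iff_lt (h _).2 (hu ▸ (h' _).2)).symm

theorem IsOrbit.lt_iff_future (h : T.IsOrbit z u) (h' : T.IsOrbit z' u') {i j : ℤ} {m : ℕ}
    (ha : ∀ t : ℤ, 0 ≤ t → t < m → u (i + t) = u' (j + t)) (hne : u (i + m) ≠ u' (j + m)) :
    z i < z' j ↔ T.lo (u (i + m)) < T.lo (u' (j + m)) := by
  rw [h.lt_iff_of_agree h' ha]
  exact lt_iff_lo_lt hne (h _).2 (h' _).2

/-- At the nearest past difference `T` reverses the order of the pieces; the common letters after it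
preserve the outcome. -/
theorem IsOrbit.lt_iff_past (hT : T.IsSymmetric) (h : T.IsOrbit z u) (h' : T.IsOrbit z' u')
    {i j : ℤ} {m : ℕ} (ha : ∀ t : ℤ, 0 ≤ t → t < m → u (i - 1 - t) = u' (j - 1 - t))
    (hne : u (i - 1 - m) ≠ u' (j - 1 - m)) :
    z i < z' j ↔ T.lo (u' (j - 1 - m)) < T.lo (u (i - 1 - m)) := by
  have h1 := h.lt_iff_of_agree h' (i := i - m) (j := j - m) (m := m) (fun t h0 ht => by
    have := ha (m - 1 - t) (by omega) (by omega)
    rwa [show i - 1 - (m - 1 - t) = i - m + t by ring,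
      show j - 1 - (m - 1 - t) = j - m + t by ring] at this)
  rw [sub_add_cancel, sub_add_cancel] at h1
  rw [← h1, show i - m = i - 1 - m + 1 by ring, show j - m = j - 1 - m + 1 by ring, (h _).1,
    (h' _).1]
  exact hT.toFun_lt_iff hne (h _).2 (h' _).2

theorem IsOrbit.lo_lt_iff_of_agree (hT : T.IsSymmetric) (h : T.IsOrbit z u) (h' : T.IsOrbit z' u')
    {i j : ℤ} {m : ℕ} (hl : u (i - 1) ≠ u' (j - 1))
    (ha : ∀ t : ℤ, 0 ≤ t → t < m → u (i + t) = u' (j + t)) (hr : u (i + m) ≠ u' (j + m)) :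
    T.lo (u (i + m)) < T.lo (u' (j + m)) ↔ T.lo (u' (j - 1)) < T.lo (u (i - 1)) := by
  rw [← h.lt_iff_future h' ha hr]
  have := h.lt_iff_past hT h' (i := i) (j := j) (m := 0) (fun t h0 ht => by simp at ht; omega)
    (by simpa using hl)
  simpa using this

theorem IsOrbit.orderCondition (hT : T.IsSymmetric) (h : T.IsOrbit z u) :
    OrderCondition (fun k => T.lo (u k)) := by
  intro i j n h1 h2 hn
  lift n to ℕ using hn
  by_contra hlt
  push Not at hlt
  have hne : u (i + n) ≠ u (j + n) := fun he => by rw [he] at hlt; exact lt_irrefl _ hlt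
  have hne' : u (i - 1) ≠ u (j - 1) := fun he => by simp only [he] at h1; exact lt_irrefl _ h1
  have := (h.lo_lt_iff_of_agree hT h hne' (fun t h0 ht => lo_injective (h2 t h0 ht)) hne).mp hlt
  exact absurd h1 this.not_gt

end GIET

namespace GIET

variable {A : Type*} {T : GIET A} {z z' : ℤ → ℝ} {u u' : ℤ → A} {v V V' : List A}

/-! ### Return words and the induced map -/

/-- Occurrences within `V ++ v` become positions on a trajectory, so a return word can be tested on
any orbit that reads it. -/
theorem isPrefixReturnWord_iff (h : T.IsOrbit z u) {i : ℤ} (ho : Occ u (V ++ v) i) :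
    IsPrefixReturnWord T.naturalCoding v V ↔
      V ≠ [] ∧ Occ u v i ∧ ∀ k : ℤ, i < k → k < i + V.length → ¬ Occ u v k := by
  have hl := occ_append.mp ho
  constructor
  · rintro ⟨h1, h2, h3⟩
    refine ⟨h1, ?_, fun k hk1 hk2 hk => ?_⟩
    · have := ((ho.occursAt_iff 0).mp ((h3 0).mpr (Or.inl rfl))).2
      simpa using this
    · obtain ⟨n, rfl⟩ : ∃ n : ℕ, k = i + n := ⟨(k - i).toNat, by omega⟩
      have := (h3 n).mp ((ho.occursAt_iff n).mpr ⟨by simp; omega, hk⟩)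
      omega
  · rintro ⟨h1, h2, h3⟩
    refine ⟨h1, h.mem_naturalCoding ho, fun n => ?_⟩
    rw [ho.occursAt_iff, List.length_append]
    constructor
    · rintro ⟨h4, h5⟩
      by_contra hn
      push Not at hn
      exact h3 (i + n) (by omega) (by omega) h5
    · rintro (rfl | rfl)
      · exact ⟨by omega, by simpa using h2⟩
      · exact ⟨le_rfl, hl.2⟩

theorem IsOrbit.returnTime_eq (h : T.IsOrbit z u) {i : ℤ} {n : ℕ} (hn : 0 < n)
    (ho : Occ u v (i + n)) (hno : ∀ k : ℤ, i < k → k < i + n → ¬ Occ u v k) :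
    T.returnTime v (z i) = n := by
  unfold returnTime
  have hset : {m : ℕ | 0 < m ∧ T.toFun^[m] (z i) ∈ T.cylinder v} =
      {m : ℕ | 0 < m ∧ Occ u v (i + m)} := by
    ext m
    simp only [mem_ofPred_eq]
    rw [h.iterate, h.mem_cylinder_iff]
  rw [hset]
  refine le_antisymm (Nat.sInf_le ⟨hn, ho⟩) ?_
  have hmem := Nat.sInf_mem (s := {m : ℕ | 0 < m ∧ Occ u v (i + m)}) ⟨n, hn, ho⟩
  by_contra hlt
  push Not at hlt
  exact hno _ (by have := hmem.1; omega) (by omega) hmem.2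

theorem IsOrbit.mem_inducedPiece_iff (hV : IsPrefixReturnWord T.naturalCoding v V)
    (h : T.IsOrbit z u) {i : ℤ} : z i ∈ T.inducedPiece v V ↔ Occ u (V ++ v) i := by
  constructor
  · rintro ⟨h1, h2, h3⟩
    have hpos : 0 < V.length := List.length_pos_iff.mpr hV.1
    have hmem : V.length ∈ {m : ℕ | 0 < m ∧ T.toFun^[m] (z i) ∈ T.cylinder v} := by
      rw [← h2]
      refine Nat.sInf_mem ?_
      -- A point that never returns has return time `sInf ∅ = 0`, whereas `V` is nonempty.
      by_contra hemp
      rw [not_nonempty_iff_eq_empty] at hemp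
      unfold returnTime at h2
      rw [hemp, Nat.sInf_empty] at h2
      omega
    have h4 := hmem.2
    rw [h.iterate, h.mem_cylinder_iff] at h4
    exact occ_append.mpr ⟨h.mem_cylinder_iff.mp h3, h4⟩
  · intro ho
    obtain ⟨h1, h2, h3⟩ := (isPrefixReturnWord_iff h ho).mp hV
    have hl := occ_append.mp ho
    exact ⟨h.mem_cylinder_iff.mpr h2, h.returnTime_eq (List.length_pos_iff.mpr h1) hl.2 h3,
      h.mem_cylinder_iff.mpr hl.1⟩

theorem IsOrbit.inducedMap_eq (hV : IsPrefixReturnWord T.naturalCoding v V) (h : T.IsOrbit z u)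
    {i : ℤ} (ho : Occ u (V ++ v) i) : T.inducedMap v (z i) = z (i + V.length) := by
  unfold inducedMap
  rw [((h.mem_inducedPiece_iff hV).mpr ho).2.1, h.iterate]

theorem exists_orbit_of_mem_inducedPiece {x : ℝ} (hV : IsPrefixReturnWord T.naturalCoding v V)
    (hx : x ∈ T.inducedPiece v V) : ∃ z u, T.IsOrbit z u ∧ z 0 = x ∧ Occ u (V ++ v) 0 := by
  obtain ⟨z, u, h, rfl⟩ := T.exists_orbit hx.1.1
  exact ⟨z, u, h, rfl, (h.mem_inducedPiece_iff hV).mp hx⟩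

/-- Two distinct complete returns to `v`, read from the left, are distinguished by a letter. -/
theorem exists_first_difference (hV : IsPrefixReturnWord T.naturalCoding v V)
    (hV' : IsPrefixReturnWord T.naturalCoding v V') (hne : V ≠ V') (h : T.IsOrbit z u)
    (h' : T.IsOrbit z' u') {i j : ℤ} (ho : Occ u (V ++ v) i) (ho' : Occ u' (V' ++ v) j) :
    ∃ m : ℕ, m < V.length + v.length ∧ m < V'.length + v.length ∧
      (∀ t : ℤ, 0 ≤ t → t < m → u (i + t) = u' (j + t)) ∧ u (i + m) ≠ u' (j + m) := by
  obtain ⟨h1, h2, h3⟩ := (isPrefixReturnWord_iff h ho).mp hV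
  obtain ⟨h1', h2', h3'⟩ := (isPrefixReturnWord_iff h' ho').mp hV'
  have hl := occ_append.mp ho
  have hl' := occ_append.mp ho'
  have hp := List.length_pos_iff.mpr h1
  have hp' := List.length_pos_iff.mpr h1'
  by_contra hcon
  have hall : ∀ t : ℤ, 0 ≤ t → t < (min V.length V'.length + v.length : ℕ) →
      u (i + t) = u' (j + t) := by
    by_contra hne
    obtain ⟨t, h0, ht, hnt, hs⟩ := exists_first_ne hne
    lift t to ℕ using h0
    exact hcon ⟨t, by omega, by omega, hs, hnt⟩
  -- If the lengths differed, the final `v` of the shorter return would occur strictly inside the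
  -- longer one.
  have hlen : V.length = V'.length := by
    rcases lt_trichotomy V.length V'.length with hlt | heq | hlt
    · refine absurd ?_ (h3' (j + V.length) (by omega) (by omega))
      refine hl.2.of_agree (fun t h0 ht => ?_)
      rw [add_assoc, add_assoc, hall _ (by omega) (by omega)]
    · exact heq
    · refine absurd ?_ (h3 (i + V'.length) (by omega) (by omega))
      refine hl'.2.of_agree (fun t h0 ht => ?_)
      rw [add_assoc, add_assoc, hall _ (by omega) (by omega)]
  exact hne ((hl.1.of_agree (fun t h0 ht => (hall t h0 (by omega)).symm)).eq_of_length_eq hl'.1 hlen)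

/-- Two distinct complete returns to `v`, read from the right, are distinguished by a letter. -/
theorem exists_last_difference (hV : IsPrefixReturnWord T.naturalCoding v V)
    (hV' : IsPrefixReturnWord T.naturalCoding v V') (hne : V ≠ V') (h : T.IsOrbit z u)
    (h' : T.IsOrbit z' u') {i j : ℤ} (ho : Occ u (V ++ v) i) (ho' : Occ u' (V' ++ v) j) :
    ∃ m : ℕ, m < V.length ∧ m < V'.length ∧
      (∀ t : ℤ, 0 ≤ t → t < m → u (i + V.length - 1 - t) = u' (j + V'.length - 1 - t)) ∧
      u (i + V.length - 1 - m) ≠ u' (j + V'.length - 1 - m) := by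
  obtain ⟨h1, h2, h3⟩ := (isPrefixReturnWord_iff h ho).mp hV
  obtain ⟨h1', h2', h3'⟩ := (isPrefixReturnWord_iff h' ho').mp hV'
  have hl := occ_append.mp ho
  have hl' := occ_append.mp ho'
  have hp := List.length_pos_iff.mpr h1
  have hp' := List.length_pos_iff.mpr h1'
  by_contra hcon
  have hall0 : ∀ t : ℤ, 0 ≤ t → t < (min V.length V'.length : ℕ) →
      u (i + V.length - 1 - t) = u' (j + V'.length - 1 - t) := by
    by_contra hne
    obtain ⟨t, h0, ht, hnt, hs⟩ := exists_first_ne hne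
    lift t to ℕ using h0
    exact hcon ⟨t, by omega, by omega, hs, hnt⟩
  -- Negative `t` reaches into the final `v`, common to both, so that the whole initial `v` of the
  -- shorter return can be copied into the longer one.
  have hall : ∀ t : ℤ, -v.length ≤ t → t < (min V.length V'.length : ℕ) →
      u (i + V.length - 1 - t) = u' (j + V'.length - 1 - t) := by
    intro t ht ht'
    by_cases h0 : 0 ≤ t
    · exact hall0 t h0 ht'
    · have := hl.2.agree hl'.2 (t := -1 - t) (by omega) (by omega)
      rwa [show i + (V.length : ℤ) + (-1 - t) = i + V.length - 1 - t by ring,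
        show j + (V'.length : ℤ) + (-1 - t) = j + V'.length - 1 - t by ring] at this
  have hlen : V.length = V'.length := by
    rcases lt_trichotomy V.length V'.length with hlt | heq | hlt
    · refine absurd ?_ (h3' (j + (V'.length - V.length)) (by omega) (by omega))
      refine h2.of_agree (fun t h0 ht => ?_)
      have := hall (V.length - 1 - t) (by omega) (by omega)
      rw [show i + t = i + V.length - 1 - (V.length - 1 - t) by ring, this]
      congr 1; ring
    · exact heq
    · refine absurd ?_ (h3 (i + (V.length - V'.length)) (by omega) (by omega))
      refine h2'.of_agree (fun t h0 ht => ?_)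
      have := hall (V'.length - 1 - t) (by omega) (by omega)
      rw [show j + t = j + V'.length - 1 - (V'.length - 1 - t) by ring, ← this]
      congr 1; ring
  refine hne ((hl.1.of_agree (fun t h0 ht => ?_)).eq_of_length_eq hl'.1 hlen)
  have := hall (V.length - 1 - t) (by omega) (by omega)
  rw [show i + t = i + V.length - 1 - (V.length - 1 - t) by ring, this, ← hlen]
  congr 1; ring

/-- The order of the defining intervals of the induced map, read on any two orbits. -/
theorem orderD_inducedPiece_iff (hV : IsPrefixReturnWord T.naturalCoding v V)
    (hV' : IsPrefixReturnWord T.naturalCoding v V') (hne : V ≠ V') (h : T.IsOrbit z u)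
    (h' : T.IsOrbit z' u') {i j : ℤ} (ho : Occ u (V ++ v) i) (ho' : Occ u' (V' ++ v) j) :
    (∀ x ∈ T.inducedPiece v V, ∀ y ∈ T.inducedPiece v V', x < y) ↔ z i < z' j := by
  constructor
  · exact fun H => H _ ((h.mem_inducedPiece_iff hV).mpr ho) _ ((h'.mem_inducedPiece_iff hV').mpr ho')
  · intro hlt x hx y hy
    -- The deciding letter lies within the two complete returns, so every pair of points of the two
    -- pieces sees it.
    obtain ⟨m, hm, hm', ha, hd⟩ := exists_first_difference hV hV' hne h h' ho ho'
    rw [h.lt_iff_future h' ha hd] at hlt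
    obtain ⟨zx, ux, hzx, rfl, hox⟩ := exists_orbit_of_mem_inducedPiece hV hx
    obtain ⟨zy, uy, hzy, rfl, hoy⟩ := exists_orbit_of_mem_inducedPiece hV' hy
    have ex : ∀ t : ℤ, 0 ≤ t → t ≤ m → ux (0 + t) = u (i + t) := fun t h0 ht =>
      hox.agree ho h0 (by rw [List.length_append]; push_cast; omega)
    have ey : ∀ t : ℤ, 0 ≤ t → t ≤ m → uy (0 + t) = u' (j + t) := fun t h0 ht =>
      hoy.agree ho' h0 (by rw [List.length_append]; push_cast; omega)
    rw [hzx.lt_iff_future hzy (m := m)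
      (fun t h0 ht => by rw [ex t h0 ht.le, ey t h0 ht.le, ha t h0 ht])
      (by rwa [ex m (by omega) le_rfl, ey m (by omega) le_rfl]), ex m (by omega) le_rfl,
      ey m (by omega) le_rfl]
    exact hlt

/-- The order of the images of the defining intervals of the induced map, read on any two
orbits. -/
theorem orderA_inducedPiece_iff (hT : T.IsSymmetric) (hV : IsPrefixReturnWord T.naturalCoding v V)
    (hV' : IsPrefixReturnWord T.naturalCoding v V') (hne : V ≠ V') (h : T.IsOrbit z u)
    (h' : T.IsOrbit z' u') {i j : ℤ} (ho : Occ u (V ++ v) i) (ho' : Occ u' (V' ++ v) j) :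
    (∀ x ∈ T.inducedMap v '' T.inducedPiece v V, ∀ y ∈ T.inducedMap v '' T.inducedPiece v V',
      x < y) ↔ z (i + V.length) < z' (j + V'.length) := by
  rw [forall_mem_image]
  simp only [forall_mem_image]
  constructor
  · intro H
    have := H ((h.mem_inducedPiece_iff hV).mpr ho) ((h'.mem_inducedPiece_iff hV').mpr ho')
    rwa [h.inducedMap_eq hV ho, h'.inducedMap_eq hV' ho'] at this
  · intro hlt x hx y hy
    obtain ⟨m, hm, hm', ha, hd⟩ := exists_last_difference hV hV' hne h h' ho ho'
    rw [h.lt_iff_past hT h' ha hd] at hlt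
    obtain ⟨zx, ux, hzx, rfl, hox⟩ := exists_orbit_of_mem_inducedPiece hV hx
    obtain ⟨zy, uy, hzy, rfl, hoy⟩ := exists_orbit_of_mem_inducedPiece hV' hy
    rw [hzx.inducedMap_eq hV hox, hzy.inducedMap_eq hV' hoy]
    have ex : ∀ t : ℤ, 0 ≤ t → t ≤ m → ux (0 + V.length - 1 - t) = u (i + V.length - 1 - t) := by
      intro t h0 ht
      have := hox.agree ho (t := V.length - 1 - t) (by omega)
        (by rw [List.length_append]; push_cast; omega)
      rw [show 0 + (V.length : ℤ) - 1 - t = 0 + (V.length - 1 - t) by ring, this]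
      congr 1; ring
    have ey : ∀ t : ℤ, 0 ≤ t → t ≤ m →
        uy (0 + V'.length - 1 - t) = u' (j + V'.length - 1 - t) := by
      intro t h0 ht
      have := hoy.agree ho' (t := V'.length - 1 - t) (by omega)
        (by rw [List.length_append]; push_cast; omega)
      rw [show 0 + (V'.length : ℤ) - 1 - t = 0 + (V'.length - 1 - t) by ring, this]
      congr 1; ring
    rw [hzx.lt_iff_past hT hzy (m := m)
      (fun t h0 ht => by rw [ex t h0 ht.le, ey t h0 ht.le, ha t h0 ht])
      (by rwa [ex m (by omega) le_rfl, ey m (by omega) le_rfl]), ex m (by omega) le_rfl,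
      ey m (by omega) le_rfl]
    exact hlt

theorem inducedIsSymmetric_of_forall (hT : T.IsSymmetric)
    (H : ∀ V V' : List A, IsPrefixReturnWord T.naturalCoding v V →
      IsPrefixReturnWord T.naturalCoding v V' → V ≠ V' → ∀ (z z' : ℤ → ℝ) (u u' : ℤ → A),
      T.IsOrbit z u → T.IsOrbit z' u' → Occ u (V ++ v) 0 → Occ u' (V' ++ v) 0 →
      (z V.length < z' V'.length ↔ z' 0 < z 0)) :
    T.InducedIsSymmetric v := by
  rintro ⟨V, hV⟩ ⟨V', hV'⟩
  obtain ⟨z, u, h, ho⟩ := mem_naturalCoding_iff.mp hV.2.1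
  obtain ⟨z', u', h', ho'⟩ := mem_naturalCoding_iff.mp hV'.2.1
  change (∀ x ∈ T.inducedMap v '' T.inducedPiece v V,
    ∀ y ∈ T.inducedMap v '' T.inducedPiece v V', x < y) ↔
    ∀ x ∈ T.inducedPiece v V', ∀ y ∈ T.inducedPiece v V, x < y
  -- The piece of a return word is nonempty, so for equal words both sides are false.
  by_cases hne : V = V'
  · subst hne
    have hx := (h.mem_inducedPiece_iff hV).mpr ho
    exact ⟨fun H => absurd (H _ ⟨_, hx, rfl⟩ _ ⟨_, hx, rfl⟩) (lt_irrefl _),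
      fun H => absurd (H _ hx _ hx) (lt_irrefl _)⟩
  · rw [orderA_inducedPiece_iff hT hV hV' hne h h' ho ho',
      orderD_inducedPiece_iff hV' hV (Ne.symm hne) h' h ho' ho]
    simpa using H V V' hV hV' hne z z' u u' h h' ho ho'

end GIET

/-! ### Palindromic words as palindromic factors of sequences -/

theorem Occ.palOn {A : Type*} {u : ℤ → A} {w : List A} {i : ℤ} (ho : Occ u w i)
    (hw : IsPalindrome w) (g : A → ℝ) : PalOn (fun k => g (u k)) i (i + w.length) := by
  intro k h1 h2
  obtain ⟨n, rfl⟩ : ∃ n : ℕ, k = i + n := ⟨(k - i).toNat, by omega⟩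
  have hn : n < w.length := by omega
  have e1 := ho n hn
  have e2 := ho (w.length - 1 - n) (by omega)
  have e3 : w.reverse[n]'(by simpa using hn) = w[n] := by
    simp only [show w.reverse = w from hw]
  rw [List.getElem_reverse] at e3
  simp only
  rw [e1, show i + (i + (w.length : ℤ)) - 1 - (i + n) = i + ((w.length - 1 - n : ℕ) : ℤ) by omega,
    e2, e3]

theorem Occ.isPalindrome {A : Type*} {u : ℤ → A} {w : List A} {i : ℤ} (ho : Occ u w i)
    {g : A → ℝ} (hg : Function.Injective g)
    (hp : PalOn (fun k => g (u k)) i (i + w.length)) : IsPalindrome w := by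
  refine List.ext_getElem (by simp) fun n h1 h2 => ?_
  rw [List.getElem_reverse, ← ho n h2, ← ho (w.length - 1 - n) (by omega)]
  have := hg (hp (i + n) (by omega) (by omega))
  rw [this]
  congr 1; omega

theorem occ_reverse_iff {A : Type*} {u : ℤ → A} {w : List A} {i : ℤ} :
    Occ u w.reverse i ↔ ∀ (k : ℕ) (hk : k < w.length), u (i + w.length - 1 - k) = w[k] := by
  constructor
  · intro h k hk
    have := h (w.length - 1 - k) (by simp; omega)
    rw [List.getElem_reverse] at this
    rw [show i + (w.length : ℤ) - 1 - k = i + ((w.length - 1 - k : ℕ) : ℤ) by omega, this]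
    congr 1; omega
  · intro h k hk
    have hk' : k < w.length := by simpa using hk
    rw [List.getElem_reverse, ← h (w.length - 1 - k) (by omega)]
    congr 1; omega

namespace GIET

variable {A : Type*} {T : GIET A} {z z' : ℤ → ℝ} {u u' : ℤ → A} {v V V' w : List A}

/-! ### Extension to a shortest bispecial word -/

theorem mem_naturalCoding_of_infix {s : List A} (h : s <:+: w) (hw : w ∈ T.naturalCoding) :
    s ∈ T.naturalCoding := by
  obtain ⟨p, q, rfl⟩ := h
  obtain ⟨z, u, hz, ho⟩ := mem_naturalCoding_iff.mp hw
  exact hz.mem_naturalCoding (occ_append.mp (occ_append.mp ho).1).2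

/-- If `w` is a shortest bispecial word containing `v`, each occurrence of `v` in a trajectory
extends to an occurrence of `w`. -/
theorem exists_unique_extension (hw : IsShortestBispecialContaining T.naturalCoding v w) :
    ∃ α β, w = α ++ v ++ β ∧ ∀ (z : ℤ → ℝ) (u : ℤ → A), T.IsOrbit z u → ∀ i : ℤ, Occ u v i →
      Occ u w (i - α.length) := by
  obtain ⟨⟨⟨hwL, a, b, hab, hwa, hwb⟩, -, c, d, hcd, hcw, hdw⟩, hvw, hmin⟩ := hw
  have main : ∀ n : ℕ, ∀ α β : List A, α ++ v ++ β <:+: w →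
      w.length = (α ++ v ++ β).length + n →
      (∀ (z : ℤ → ℝ) (u : ℤ → A), T.IsOrbit z u → ∀ i : ℤ, Occ u v i →
        Occ u (α ++ v ++ β) (i - α.length)) →
      ∃ α β, w = α ++ v ++ β ∧ ∀ (z : ℤ → ℝ) (u : ℤ → A), T.IsOrbit z u → ∀ i : ℤ, Occ u v i →
        Occ u w (i - α.length) := by
    intro n
    induction n with
    | zero =>
      intro α β hi hl he
      have := hi.eq_of_length (by omega)
      exact ⟨α, β, this.symm, this ▸ he⟩
    | succ n ih =>
      intro α β hi hl he
      have hL := mem_naturalCoding_of_infix hi hwL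
      obtain ⟨p, q, hpq⟩ := hi
      -- A factor of `w` containing `v` and shorter than `w` is not bispecial, so its next letter is
      -- forced on some side. If `w` had no letter left on that side, the factor would inherit the
      -- specialness of `w`.
      by_cases hbi : IsBispecial T.naturalCoding (α ++ v ++ β)
      · have := hmin _ hbi ⟨α, β, rfl⟩
        omega
      · by_cases hr : IsRightSpecial T.naturalCoding (α ++ v ++ β)
        · have hls : ¬ IsLeftSpecial T.naturalCoding (α ++ v ++ β) := fun h => hbi ⟨hr, h⟩
          rcases List.eq_nil_or_concat p with rfl | ⟨p', e, rfl⟩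
          · refine absurd ⟨hL, c, d, hcd, mem_naturalCoding_of_infix ⟨[], q, ?_⟩ hcw,
              mem_naturalCoding_of_infix ⟨[], q, ?_⟩ hdw⟩ hls
            all_goals simpa using hpq
          · have hin : (e :: α) ++ v ++ β <:+: w := ⟨p', q, by simpa using hpq⟩
            refine ih (e :: α) β hin (by simp at hl ⊢; omega) (fun z u hz i ho => ?_)
            have ho1 := he z u hz i ho
            have hu : u (i - α.length - 1) = e := by
              by_contra hne
              refine hls ⟨hL, _, _, hne, hz.mem_naturalCoding (i := i - α.length - 1)
                (occ_cons.mpr ⟨rfl, ?_⟩), mem_naturalCoding_of_infix hin hwL⟩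
              rwa [sub_add_cancel]
            rw [List.cons_append, List.cons_append, occ_cons, List.length_cons]
            push_cast
            rw [show i - ((α.length : ℤ) + 1) = i - α.length - 1 by ring, sub_add_cancel]
            exact ⟨hu, ho1⟩
        · rcases q with _ | ⟨e, q'⟩
          · refine absurd ⟨hL, a, b, hab, mem_naturalCoding_of_infix ⟨p, [], ?_⟩ hwa,
              mem_naturalCoding_of_infix ⟨p, [], ?_⟩ hwb⟩ hr
            all_goals rw [← hpq]; simp
          · have hin : (α ++ v ++ β) ++ [e] <:+: w := ⟨p, q', by rw [← hpq]; simp⟩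
            have hin' : α ++ v ++ (β ++ [e]) <:+: w := by simpa using hin
            refine ih α (β ++ [e]) hin' (by simp at hl ⊢; omega) (fun z u hz i ho => ?_)
            have ho1 := he z u hz i ho
            have hu : u (i - α.length + (α ++ v ++ β).length) = e := by
              by_contra hne
              exact hr ⟨hL, _, _, hne, hz.mem_naturalCoding (i := i - α.length)
                (occ_append.mpr ⟨ho1, occ_singleton.mpr rfl⟩), mem_naturalCoding_of_infix hin hwL⟩
            rw [← List.append_assoc]
            exact occ_append.mpr ⟨ho1, occ_singleton.mpr hu⟩
  refine main (w.length - v.length) [] [] (by simpa using hvw) ?_ (by simp)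
  have := hvw.length_le
  simp; omega

/-! ### The palindromic case -/

theorem inducedIsSymmetric_of_isPalindrome (hT : T.IsSymmetric) {α β : List A}
    (hpal : IsPalindrome (α ++ v ++ β))
    (hext : ∀ (z : ℤ → ℝ) (u : ℤ → A), T.IsOrbit z u → ∀ i : ℤ, Occ u v i →
      Occ u (α ++ v ++ β) (i - α.length)) : T.InducedIsSymmetric v := by
  have hret : ∀ (V : List A) (z : ℤ → ℝ) (u : ℤ → A), IsPrefixReturnWord T.naturalCoding v V →
      T.IsOrbit z u → Occ u (V ++ v) 0 → Occ u (α ++ v ++ β) (0 - α.length) ∧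
      ∀ k : ℤ, -α.length ≤ k → k < V.length + v.length + β.length →
        u k = u (V.length - α.length + v.length + β.length - 1 - k) := by
    intro V z u hV h ho
    obtain ⟨h1, h2, h3⟩ := (isPrefixReturnWord_iff h ho).mp hV
    have hl := occ_append.mp ho
    have o1 := hext z u h _ h2
    have o2 := hext z u h _ hl.2
    refine ⟨o1, fun k hk1 hk2 => ?_⟩
    -- An intermediate occurrence of `α ++ v ++ β` would contain a forbidden `v`, so this is a
    -- complete return to a palindrome.
    have hP := (isMirrorReturn_of_palOn (u := fun k => T.lo (u k)) (s := 0 - α.length)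
      (o1.palOn hpal T.lo) (c := 0 - α.length) (c' := 0 + V.length - α.length)
      (fun t _ _ => rfl) (fun t h0 ht => by rw [o2.agree o1 h0 ht]) (fun k hk hk' hk'' => by
        have o3 : Occ u (α ++ v ++ β) k :=
          o1.of_agree (fun t h0 ht => lo_injective (hk'' t h0 ht))
        exact h3 (k + α.length) (by omega) (by omega)
          (occ_append.mp (occ_append.mp o3).1).2)).palOn (h.orderCondition hT)
    have := lo_injective (hP k (by omega) (by simp; omega))
    rw [this]
    congr 1
    simp
    ring
  refine inducedIsSymmetric_of_forall hT ?_
  intro V V' hV hV' hne z z' u u' h h' ho ho'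
  obtain ⟨o1, m1⟩ := hret V z u hV h ho
  obtain ⟨o2, m2⟩ := hret V' z' u' hV' h' ho'
  obtain ⟨m, hm, hm', ha, hd⟩ := exists_first_difference hV hV' hne h h' ho ho'
  have hag : ∀ t : ℤ, -α.length ≤ t → t < v.length + β.length → u t = u' t := by
    intro t h0 ht
    have := o1.agree o2 (t := t + α.length) (by omega) (by simp; omega)
    rwa [show 0 - (α.length : ℤ) + (t + α.length) = t by ring] at this
  have hmge : v.length + β.length ≤ m := by
    by_contra hlt
    exact hd (by rw [zero_add]; exact hag m (by omega) (by omega))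
  -- Reflection in the complete return sends position `m` to `V.length - 1 - m'`; the same `m'`
  -- serves `V'`, whatever its length.
  obtain ⟨m', hm'e⟩ : ∃ m' : ℕ, (m' : ℤ) = m + α.length - v.length - β.length :=
    ⟨(m + α.length - v.length - β.length : ℤ).toNat, by omega⟩
  have e1 : u (V.length - 1 - m') = u (0 + m) := by
    rw [m1 (0 + m) (by omega) (by omega)]
    congr 1; omega
  have e2 : u' (V'.length - 1 - m') = u' (0 + m) := by
    rw [m2 (0 + m) (by omega) (by omega)]
    congr 1; omega
  have hd' : u' (0 + m) ≠ u (0 + m) := hd.symm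
  rw [h'.lt_iff_future h (fun t h0 ht => (ha t h0 ht).symm) hd',
    h.lt_iff_past hT h' (m := m') (fun t h0 ht => ?_) (by rwa [e1, e2]), e1, e2]
  rw [m1 _ (by omega) (by omega), m2 (V'.length - 1 - t) (by omega) (by omega),
    show (V.length : ℤ) - α.length + v.length + β.length - 1 - (V.length - 1 - t)
      = v.length + β.length - α.length + t by ring,
    show (V'.length : ℤ) - α.length + v.length + β.length - 1 - (V'.length - 1 - t)
      = v.length + β.length - α.length + t by ring]
  -- Negative positions fall in the common left context `α`.
  by_cases hlt : v.length + β.length - α.length + t < 0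
  · exact hag _ (by omega) (by omega)
  · have := ha (v.length + β.length - α.length + t) (by omega) (by omega)
    rwa [zero_add] at this

end GIET

namespace GIET

variable {A : Type*} {T : GIET A} {z z' : ℤ → ℝ} {u u' : ℤ → A} {v : List A}

/-! ### Recurrence of standard interval exchange transformations -/

theorem IsOrbit.eq_sub_of_eq (h : T.IsOrbit z u) (h' : T.IsOrbit z' u') {i j : ℤ}
    (he : z i = z' j) (n : ℕ) : z (i - n) = z' (j - n) := by
  induction n with
  | zero => simpa using he
  | succ n ih =>
    refine T.bijOn.injOn (h.mem_Ico _) (h'.mem_Ico _) ?_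
    rw [← (h _).1, ← (h' _).1]
    push_cast
    rw [show i - ((n : ℤ) + 1) + 1 = i - n by ring, show j - ((n : ℤ) + 1) + 1 = j - n by ring]
    exact ih

/-- The orbit of a point to the right of `z 0` is a translate of `z` as long as the points stay in
the same defining intervals. -/
theorem IsStandard.exists_translated_orbit (hS : T.IsStandard) (h : T.IsOrbit z u) {t : ℝ}
    (ht : 0 ≤ t) (ht0 : z 0 + t < T.hi (u 0)) :
    ∃ z' u', T.IsOrbit z' u' ∧ ∀ n : ℕ, (∀ i : ℕ, i < n → z i + t < T.hi (u i)) →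
      (∀ i : ℕ, i ≤ n → z' i = z i + t) ∧ ∀ i : ℕ, i < n → u' i = u i := by
  have hmem : ∀ i : ℤ, z i + t < T.hi (u i) → z i + t ∈ T.piece (u i) := fun i hi =>
    ⟨(h i).2.1.trans (le_add_of_nonneg_right ht), hi⟩
  obtain ⟨z', u', h', hz'⟩ := T.exists_orbit (T.piece_subset _ (hmem 0 ht0))
  refine ⟨z', u', h', fun n hn => ?_⟩
  have hz : ∀ i : ℕ, i ≤ n → z' i = z i + t := by
    intro i
    induction i with
    | zero => intro _; simpa using hz'
    | succ i ih =>
      intro hi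
      obtain ⟨c, hc⟩ := hS (u i)
      push_cast
      rw [(h' _).1, (h _).1, ih (by omega), hc _ (hmem i (hn i (by omega))), hc _ (h i).2]
      ring
  refine ⟨hz, fun i hi => ?_⟩
  have := (h' i).2
  rw [hz i hi.le] at this
  exact T.eq_of_mem_piece this (hmem i (hn i hi))

theorem exists_lo_eq_hi {e : A} (h : T.hi e ∈ Ico T.left T.right) : ∃ f, T.hi e = T.lo f := by
  obtain ⟨f, hf⟩ := T.exists_mem_piece h
  refine ⟨f, le_antisymm ?_ hf.1⟩
  rcases lt_trichotomy (T.lo e) (T.lo f) with hlt | heq | hlt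
  · exact hi_le_lo hlt
  · rw [← lo_injective heq] at hf
    exact absurd hf.2 (lt_irrefl _)
  · exact absurd hf.2 (not_lt.mpr ((hi_le_lo hlt).trans (T.lo_lt_hi e).le))

open Filter Topology in
/-- The induced maps of standard interval exchange transformations exist. -/
theorem IsStandard.inducedExists [Finite A] (hS : T.IsStandard) (v : List A) :
    T.InducedExists v := by
  intro x hx
  obtain ⟨z, u, h, rfl⟩ := T.exists_orbit hx.1
  by_contra hcon
  have hno : ∀ n : ℕ, 0 < n → ¬ Occ u v n := by
    intro n hn ho
    refine hcon ⟨n, hn, ?_⟩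
    rw [h.iterate, h.mem_cylinder_iff, zero_add]
    exact ho
  have hv := h.mem_cylinder_iff.mp hx
  -- the translations by which the orbit first meets an endpoint of a defining interval
  set D : Set ℝ := {δ | 0 < δ ∧ ∃ e, ∃ n : ℕ, v.length + 1 ≤ n ∧ z n + δ = T.lo e ∧
    ∀ i : ℕ, i < n → z i + δ < T.hi (u i)} with hD
  -- By injectivity, `z 0 + δ₁` would be a later point of the orbit of `z 0 + δ₂`, which would read
  -- `v` at time `n₂ - n₁`. As `v.length < n₁`, this occurrence ends before `n₂`, where the coding
  -- is still that of `z`: a forbidden return. Hence `D` injects into the alphabet.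
  have huniq : ∀ (δ₁ δ₂ : ℝ) (e : A) (n₁ n₂ : ℕ), 0 < δ₁ → 0 < δ₂ → v.length + 1 ≤ n₁ → n₁ < n₂ →
      z n₁ + δ₁ = T.lo e → z n₂ + δ₂ = T.lo e → (∀ i : ℕ, i < n₁ → z i + δ₁ < T.hi (u i)) →
      (∀ i : ℕ, i < n₂ → z i + δ₂ < T.hi (u i)) → False := by
    intro δ₁ δ₂ e n₁ n₂ h1 h2 hv1 hlt he1 he2 hc1 hc2
    obtain ⟨z₁, u₁, ho1, ht1⟩ := hS.exists_translated_orbit h h1.le (by simpa using hc1 0 (by omega))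
    obtain ⟨z₂, u₂, ho2, ht2⟩ := hS.exists_translated_orbit h h2.le (by simpa using hc2 0 (by omega))
    obtain ⟨a1, b1⟩ := ht1 n₁ hc1
    obtain ⟨a2, b2⟩ := ht2 n₂ hc2
    have heq := ho1.eq_sub_of_eq ho2 (i := n₁) (j := n₂)
      (by rw [a1 n₁ le_rfl, a2 n₂ le_rfl, he1, he2]) n₁
    have o1 : Occ u₁ v ((n₁ : ℤ) - n₁) := by
      rw [sub_self]
      refine hv.of_agree (fun t h0 ht => ?_)
      lift t to ℕ using h0
      rw [zero_add]
      exact b1 t (by omega)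
    have o2 := ho2.mem_cylinder_iff.mp (heq ▸ ho1.mem_cylinder_iff.mpr o1)
    refine hno (n₂ - n₁) (by omega) (o2.of_agree (fun t h0 ht => ?_))
    lift t to ℕ using h0
    have := b2 (n₂ - n₁ + t) (by omega)
    rw [show (n₂ : ℤ) - n₁ + t = ((n₂ - n₁ + t : ℕ) : ℤ) by omega, this]
    congr 1
  have hDfin : D.Finite := by
    have hch : ∀ δ : D, ∃ e, ∃ n : ℕ, v.length + 1 ≤ n ∧ z n + δ = T.lo e ∧
      ∀ i : ℕ, i < n → z i + δ < T.hi (u i) := fun δ => δ.2.2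
    choose f n hn hf hc using hch
    suffices hinj : Function.Injective f from @Set.toFinite _ D (Finite.of_injective f hinj)
    intro a b hab
    rcases lt_trichotomy (n a) (n b) with hlt | heq | hlt
    · exact (huniq a b (f a) _ _ a.2.1 b.2.1 (hn a) hlt (hf a) (hab ▸ hf b) (hc a) (hc b)).elim
    · have e1 := hf a
      rw [hab, ← hf b, heq] at e1
      exact Subtype.ext (add_left_cancel e1)
    · exact (huniq b a (f a) _ _ b.2.1 a.2.1 (hn b) hlt (hab ▸ hf b) (hf a) (hc b) (hc a)).elim
  obtain ⟨ε, hεD, hεi, hε⟩ : ∃ ε : ℝ, (∀ δ ∈ D, ε < δ) ∧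
      (∀ i ∈ Finset.range (v.length + 1), z i + ε < T.hi (u i)) ∧ 0 < ε := by
    have e1 : ∀ᶠ ε in 𝓝[>] (0 : ℝ), ∀ δ ∈ D, ε < δ :=
      (eventually_all_finite hDfin).mpr fun δ hδ =>
        nhdsWithin_le_nhds (eventually_lt_nhds hδ.1)
    have e2 : ∀ᶠ ε in 𝓝[>] (0 : ℝ), ∀ i ∈ Finset.range (v.length + 1), z i + ε < T.hi (u i) := by
      refine (eventually_all_finset _).mpr fun i _ => nhdsWithin_le_nhds ?_
      filter_upwards [eventually_lt_nhds (sub_pos.mpr (h i).2.2)] with ε hε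
      linarith
    exact (e1.and (e2.and self_mem_nhdsWithin)).exists
  -- At a first cut, translating by `T.hi (u n) - z n` would reach an endpoint and give an element
  -- of `D` smaller than `ε`.
  have huncut : ∀ n : ℕ, z n + ε ≤ T.hi (u n) := by
    intro n
    induction n using Nat.strong_induction_on with
    | _ n ih =>
      by_cases hn : n < v.length + 1
      · exact (hεi n (Finset.mem_range.mpr hn)).le
      by_contra hlt
      push Not at hlt
      have hδ : 0 < T.hi (u n) - z n := sub_pos.mpr (h n).2.2
      have hc : ∀ i : ℕ, i < n → z i + (T.hi (u n) - z n) < T.hi (u i) := fun i hi => by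
        have := ih i hi; linarith
      obtain ⟨z₁, u₁, ho1, ht1⟩ := hS.exists_translated_orbit h hδ.le
        (by simpa using hc 0 (by omega))
      have hz1 := (ht1 n hc).1 n le_rfl
      have hI := ho1.mem_Ico n
      rw [hz1, add_sub_cancel] at hI
      obtain ⟨f, hf⟩ := exists_lo_eq_hi hI
      have := hεD _ ⟨hδ, f, n, by omega, by rw [add_sub_cancel, hf], hc⟩
      linarith
  -- pigeonhole
  obtain ⟨n, m, hnm, hclose⟩ : ∃ n m : ℕ, n < m ∧ |z n - z m| < ε := by
    have hmaps : MapsTo (fun n : ℕ => ⌊(z n - T.left) / ε⌋) univ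
        (Icc 0 ⌊(T.right - T.left) / ε⌋) := by
      intro n _
      have hI := h.mem_Ico n
      refine ⟨Int.floor_nonneg.mpr (div_nonneg (sub_nonneg.mpr hI.1) hε.le), Int.floor_mono ?_⟩
      gcongr
      exact hI.2.le
    obtain ⟨n, -, m, -, hne, heq⟩ :=
      infinite_univ.exists_ne_map_eq_of_mapsTo hmaps (finite_Icc _ _)
    have hab := Int.abs_sub_lt_one_of_floor_eq_floor heq
    have hc : |z n - z m| < ε := by
      rw [← sub_div, sub_sub_sub_cancel_right, abs_div, abs_of_pos hε, div_lt_one hε] at hab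
      exact hab
    rcases lt_or_gt_of_ne hne with hlt | hlt
    · exact ⟨n, m, hlt, hc⟩
    · exact ⟨m, n, hlt, by rwa [abs_sub_comm]⟩
  rw [abs_lt] at hclose
  -- Translating `z 0` by the distance of the two close points keeps its coding. Pulling the
  -- coincidence back `n` steps makes `v` recur at time `m - n` in either case.
  rcases le_total (z n) (z m) with hle | hle
  · have hlt : ∀ i : ℕ, z i + (z m - z n) < T.hi (u i) := fun i => by
      have := huncut i; linarith
    obtain ⟨z₁, u₁, ho1, ht1⟩ := hS.exists_translated_orbit h (sub_nonneg.mpr hle)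
      (by simpa using hlt 0)
    have heq := ho1.eq_sub_of_eq h (i := n) (j := m)
      (by rw [(ht1 n (fun i _ => hlt i)).1 n le_rfl, add_sub_cancel]) n
    have o1 : Occ u₁ v ((n : ℤ) - n) := by
      rw [sub_self]
      refine hv.of_agree (fun t h0 ht => ?_)
      lift t to ℕ using h0
      rw [zero_add]
      exact (ht1 (t + 1) (fun i _ => hlt i)).2 t (by omega)
    have o2 := h.mem_cylinder_iff.mp (heq ▸ ho1.mem_cylinder_iff.mpr o1)
    refine hno (m - n) (by omega) ?_
    rwa [Nat.cast_sub hnm.le]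
  · have hlt : ∀ i : ℕ, z i + (z n - z m) < T.hi (u i) := fun i => by
      have := huncut i; linarith
    obtain ⟨z₁, u₁, ho1, ht1⟩ := hS.exists_translated_orbit h (sub_nonneg.mpr hle)
      (by simpa using hlt 0)
    have heq := h.eq_sub_of_eq ho1 (i := n) (j := m)
      (by rw [(ht1 m (fun i _ => hlt i)).1 m le_rfl, add_sub_cancel]) n
    rw [sub_self] at heq
    have o1 := ho1.mem_cylinder_iff.mp (heq ▸ hx)
    refine hno (m - n) (by omega) (o1.of_agree (fun t h0 ht => ?_))
    lift t to ℕ using h0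
    have := (ht1 (m - n + t + 1) (fun i _ => hlt i)).2 (m - n + t) (by omega)
    rw [show (m : ℤ) - n + t = ((m - n + t : ℕ) : ℤ) by omega, this]
    congr 1

end GIET

namespace GIET

variable {A : Type*} {T : GIET A} {z z' : ℤ → ℝ} {u u' : ℤ → A} {v w : List A}

/-! ### The non-palindromic case -/

theorem IsOrbit.exists_occ_gt (hrec : ∀ s, T.InducedExists s) (h : T.IsOrbit z u) {i : ℤ}
    (ho : Occ u w i) : ∃ j, i < j ∧ Occ u w j := by
  obtain ⟨n, hn, hm⟩ := hrec w _ (h.mem_cylinder_iff.mpr ho)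
  rw [h.iterate, h.mem_cylinder_iff] at hm
  exact ⟨i + n, by omega, hm⟩

theorem IsOrbit.exists_occ_reverse_between (hT : T.IsSymmetric) (h : T.IsOrbit z u) {i j : ℤ}
    (hij : i < j) (hi : Occ u w i) (hj : Occ u w j) (hw : ¬ IsPalindrome w) :
    ∃ k, i < k ∧ k < j ∧ Occ u w.reverse k := by
  obtain ⟨k, h1, h2, h3⟩ := exists_reverse_between (h.orderCondition hT) (n := w.length) hij
    (fun t h0 ht => by rw [hj.agree hi h0 ht]) (fun hp => hw (hi.isPalindrome lo_injective hp))
  refine ⟨k, h1, h2, occ_reverse_iff.mpr fun n hn => ?_⟩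
  have := lo_injective (h3 (w.length - 1 - n) (by omega) (by omega))
  rw [← hi n hn, show i + (n : ℤ) = i + w.length - 1 - (w.length - 1 - n) by ring, ← this]
  congr 1; ring

theorem IsOrbit.exists_occ_between_reverse (hT : T.IsSymmetric) (h : T.IsOrbit z u) {i j : ℤ}
    (hij : i < j) (hi : Occ u w.reverse i) (hj : Occ u w.reverse j) (hw : ¬ IsPalindrome w) :
    ∃ k, i < k ∧ k < j ∧ Occ u w k := by
  have := h.exists_occ_reverse_between hT hij hi hj (fun hp => hw (by
    have hp' : w.reverse.reverse = w.reverse := hp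
    rw [List.reverse_reverse] at hp'
    exact hp'.symm))
  rwa [List.reverse_reverse] at this

theorem reverse_mem_naturalCoding (hT : T.IsSymmetric) (hrec : ∀ s, T.InducedExists s)
    (hw : w ∈ T.naturalCoding) : w.reverse ∈ T.naturalCoding := by
  by_cases hp : IsPalindrome w
  · rwa [show w.reverse = w from hp]
  · obtain ⟨z, u, h, ho⟩ := mem_naturalCoding_iff.mp hw
    obtain ⟨j, hj, hoj⟩ := h.exists_occ_gt hrec ho
    obtain ⟨k, -, -, hk⟩ := h.exists_occ_reverse_between hT hj ho hoj hp
    exact h.mem_naturalCoding hk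

/-- Around a reverse occurrence `b w.reverse c`, there is a complete return to `w` in which the
first letter after `w` is `b` and the last letter before `w` is `c`. -/
theorem exists_return_of_mem (hT : T.IsSymmetric) (hrec : ∀ s, T.InducedExists s)
    (hw : ¬ IsPalindrome w) {b c : A} (hL : b :: (w.reverse ++ [c]) ∈ T.naturalCoding) :
    ∃ z u i k, T.IsOrbit z u ∧ i < k ∧ Occ u w i ∧ Occ u w k ∧
      (∀ m, i < m → m < k → ¬ Occ u w m) ∧ u (i + w.length) = b ∧ u (k - 1) = c := by
  obtain ⟨z, u, h, ho⟩ := mem_naturalCoding_iff.mp hL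
  -- Three occurrences of the extended reverse are taken so that the middle one has a `w` on either
  -- side.
  obtain ⟨n, hn, hon⟩ := h.exists_occ_gt hrec ho
  obtain ⟨n', hn', hon'⟩ := h.exists_occ_gt hrec hon
  rw [occ_cons, occ_append, occ_singleton, List.length_reverse] at ho hon hon'
  obtain ⟨hb, hj, hc⟩ := hon
  obtain ⟨i₀, hi₀, hi₀', hoi₀⟩ := h.exists_occ_between_reverse hT (by omega) ho.2.1 hj hw
  obtain ⟨k₀, hk₀, hk₀', hok₀⟩ := h.exists_occ_between_reverse hT (by omega) hj hon'.2.1 hw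
  obtain ⟨i, ⟨hi, hoi⟩, himax⟩ := Int.exists_greatest_of_bdd
    (P := fun i => i < n + 1 ∧ Occ u w i) ⟨n + 1, fun y hy => hy.1.le⟩ ⟨i₀, hi₀', hoi₀⟩
  obtain ⟨k, ⟨hk, hok⟩, hkmin⟩ := Int.exists_least_of_bdd
    (P := fun k => n + 1 < k ∧ Occ u w k) ⟨n + 1, fun y hy => hy.1.le⟩ ⟨k₀, hk₀, hok₀⟩
  have hjr := occ_reverse_iff.mp hj
  have hu := h.orderCondition hT
  have hocc_of : ∀ {m : ℤ}, (∀ t : ℤ, 0 ≤ t → t < w.length → T.lo (u (m + t)) =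
      T.lo (u (i + t))) → Occ u w m := fun hm =>
    hoi.of_agree fun t h0 ht => lo_injective (hm t h0 ht)
  have hmir : ∀ t : ℤ, 0 ≤ t → t < w.length → u (i + t) = u (n + 1 + w.length - 1 - t) := by
    intro t h0 ht
    lift t to ℕ using h0
    rw [hjr t (by omega), hoi t (by omega)]
  -- Another `w.reverse` in between would force a `w` closer to the middle than `i`. The resulting
  -- palindrome carries `b` to the letter after `w`; `hright` does the same for `c`.
  have hleft : PalOn (fun k => T.lo (u k)) i (n + 1 + w.length) := by
    refine IsMirrorReturn.palOn hu (ℓ := w.length) ⟨fun t h0 ht => by rw [hmir t h0 ht],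
      fun m h1 h2 h3 => ?_, fun m h1 h2 h3 => ?_⟩
    · have := himax m ⟨by omega, hocc_of h3⟩
      omega
    · have hom : Occ u w.reverse m := by
        refine occ_reverse_iff.mpr fun t ht => ?_
        have := lo_injective (h3 (w.length - 1 - t) (by omega) (by omega))
        rw [← hoi t ht, show m + (w.length : ℤ) - 1 - t = m + (w.length - 1 - t) by ring, this]
        congr 1; ring
      obtain ⟨m', hm1, hm2, hm3⟩ := h.exists_occ_between_reverse hT (by omega) hom hj hw
      have := himax m' ⟨hm2, hm3⟩
      omega
  have hright : PalOn (fun k => T.lo (u k)) (n + 1) (k + w.length) := by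
    refine IsMirrorReturn.palOn hu (ℓ := w.length) ⟨fun t h0 ht => ?_,
      fun m h1 h2 h3 => ?_, fun m h1 h2 h3 => ?_⟩
    · have := hmir (w.length - 1 - t) (by omega) (by omega)
      rw [show n + 1 + t = n + 1 + (w.length : ℤ) - 1 - (w.length - 1 - t) by ring, ← this,
        hoi.agree hok (by omega) (by omega)]
      congr 2; ring
    · have hom : Occ u w.reverse m := hj.of_agree fun t h0 ht =>
        lo_injective (h3 t h0 (by simpa using ht))
      obtain ⟨m', hm1, hm2, hm3⟩ := h.exists_occ_between_reverse hT h1 hj hom hw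
      have := hkmin m' ⟨hm1, hm3⟩
      omega
    · have := hkmin m ⟨h1, hocc_of fun t h0 ht => by rw [h3 t h0 ht, hmir t h0 ht]⟩
      omega
  refine ⟨z, u, i, k, h, by omega, hoi, hok, fun m h1 h2 h3 => ?_, ?_, ?_⟩
  · rcases lt_trichotomy m (n + 1) with hlt | rfl | hlt
    · have := himax m ⟨hlt, h3⟩; omega
    · exact hw (hj.eq_of_length_eq h3 (by simp))
    · have := hkmin m ⟨hlt, h3⟩; omega
  · rw [lo_injective (hleft (i + w.length) (by omega) (by omega)), ← hb]
    congr 1; ring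
  · rw [lo_injective (hright (k - 1) (by omega) (by omega)), ← hc]
    congr 1; ring

/-- A bispecial word has two bilateral extensions which differ on both sides. -/
theorem exists_bilateral_extensions (hw : IsBispecial T.naturalCoding w) :
    ∃ b c b' c', b ≠ b' ∧ c ≠ c' ∧ b :: (w ++ [c]) ∈ T.naturalCoding ∧
      b' :: (w ++ [c']) ∈ T.naturalCoding := by
  have hr : ∀ b, b :: w ∈ T.naturalCoding → ∃ c, b :: (w ++ [c]) ∈ T.naturalCoding := by
    intro b hb
    obtain ⟨z, u, h, ho⟩ := mem_naturalCoding_iff.mp hb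
    exact ⟨_, h.mem_naturalCoding (i := 0) (w := (b :: w) ++ [_])
      (occ_append.mpr ⟨ho, occ_singleton.mpr rfl⟩)⟩
  have hl : ∀ c, w ++ [c] ∈ T.naturalCoding → ∃ b, b :: (w ++ [c]) ∈ T.naturalCoding := by
    intro c hc
    obtain ⟨z, u, h, ho⟩ := mem_naturalCoding_iff.mp hc
    exact ⟨_, h.mem_naturalCoding (i := -1) (occ_cons.mpr ⟨rfl, by simpa using ho⟩)⟩
  obtain ⟨⟨-, c₁, c₂, hc, hc1, hc2⟩, -, b₁, b₂, hb, hb1, hb2⟩ := hw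
  obtain ⟨d₁, h1⟩ := hr b₁ hb1
  obtain ⟨d₂, h2⟩ := hr b₂ hb2
  by_cases hd : d₁ = d₂
  · subst hd
    obtain ⟨c, hcd, hcL⟩ : ∃ c, c ≠ d₁ ∧ w ++ [c] ∈ T.naturalCoding := by
      by_cases h : c₁ = d₁
      · exact ⟨c₂, fun h' => hc (h.trans h'.symm), hc2⟩
      · exact ⟨c₁, h, hc1⟩
    obtain ⟨b, hbL⟩ := hl c hcL
    by_cases h : b = b₁
    · exact ⟨b₂, d₁, b, c, fun h' => hb (h.symm.trans h'.symm), hcd.symm, h2, hbL⟩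
    · exact ⟨b₁, d₁, b, c, fun h' => h h'.symm, hcd.symm, h1, hbL⟩
  · exact ⟨b₁, d₁, b₂, d₂, hb, hd, h1, h2⟩

theorem isBispecial_reverse (hT : T.IsSymmetric) (hrec : ∀ s, T.InducedExists s)
    (hw : IsBispecial T.naturalCoding w) : IsBispecial T.naturalCoding w.reverse := by
  obtain ⟨⟨hL, c, c', hc, h1, h2⟩, -, b, b', hb, h3, h4⟩ := hw
  have hR := fun s : List A => reverse_mem_naturalCoding (w := s) hT hrec
  exact ⟨⟨hR _ hL, b, b', hb, by simpa using hR _ h3, by simpa using hR _ h4⟩,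
    hR _ hL, c, c', hc, by simpa using hR _ h1, by simpa using hR _ h2⟩

/-- The order condition for two bilateral extensions of a word. -/
theorem IsSymmetric.lo_lt_iff_of_extensions (hT : T.IsSymmetric) {b c b' c' : A} (hb : b ≠ b')
    (hc : c ≠ c') (h : b :: (w ++ [c]) ∈ T.naturalCoding)
    (h' : b' :: (w ++ [c']) ∈ T.naturalCoding) : T.lo c < T.lo c' ↔ T.lo b' < T.lo b := by
  obtain ⟨z, u, hz, ho⟩ := mem_naturalCoding_iff.mp h
  obtain ⟨z', u', hz', ho'⟩ := mem_naturalCoding_iff.mp h'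
  rw [occ_cons, occ_append, occ_singleton] at ho ho'
  obtain ⟨rfl, ow, rfl⟩ := ho
  obtain ⟨rfl, ow', rfl⟩ := ho'
  have := hz.lo_lt_iff_of_agree hT hz' (i := 0 + 1) (j := 0 + 1) (m := w.length) (by simpa using hb)
    (fun t h0 ht => ow.agree ow' h0 ht) hc
  simpa using this

theorem not_inducedIsSymmetric (hT : T.IsSymmetric) (hrec : ∀ s, T.InducedExists s)
    {α β : List A} (hbi : IsBispecial T.naturalCoding (α ++ v ++ β))
    (hnp : ¬ IsPalindrome (α ++ v ++ β))
    (hext : ∀ (z : ℤ → ℝ) (u : ℤ → A), T.IsOrbit z u → ∀ i : ℤ, Occ u v i →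
      Occ u (α ++ v ++ β) (i - α.length)) : ¬ T.InducedIsSymmetric v := by
  intro hS
  obtain ⟨b, c, b', c', hb, hc, hL, hL'⟩ :=
    exists_bilateral_extensions (isBispecial_reverse hT hrec hbi)
  obtain ⟨z, u, i, k, h, hik, oi, ok, hno, hub, huc⟩ := exists_return_of_mem hT hrec hnp hL
  obtain ⟨z', u', i', k', h', hik', oi', ok', hno', hub', huc'⟩ :=
    exists_return_of_mem hT hrec hnp hL'
  have hcross := hT.lo_lt_iff_of_extensions hb hc hL hL'
  have hret : ∀ (z : ℤ → ℝ) (u : ℤ → A) (i k : ℤ), T.IsOrbit z u → i < k →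
      Occ u (α ++ v ++ β) i → Occ u (α ++ v ++ β) k →
      (∀ m, i < m → m < k → ¬ Occ u (α ++ v ++ β) m) →
      Occ u (seqFactor u (i + α.length) (k - i).toNat ++ v) (i + α.length) ∧
      IsPrefixReturnWord T.naturalCoding v (seqFactor u (i + α.length) (k - i).toNat) := by
    intro z u i k h hik oi ok hno
    have o1 : Occ u (seqFactor u (i + α.length) (k - i).toNat ++ v) (i + α.length) := by
      refine occ_append.mpr ⟨occ_seqFactor _ _ _, ?_⟩
      rw [length_seqFactor, show i + (α.length : ℤ) + ((k - i).toNat : ℤ) = k + α.length by omega]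
      exact (occ_append.mp (occ_append.mp ok).1).2
    refine ⟨o1, (isPrefixReturnWord_iff h o1).mpr ⟨fun h0 => ?_, ?_, fun m h1 h2 h3 => ?_⟩⟩
    · have := congrArg List.length h0
      rw [length_seqFactor, List.length_nil] at this
      omega
    · exact (occ_append.mp (occ_append.mp oi).1).2
    · rw [length_seqFactor] at h2
      exact hno (m - α.length) (by omega) (by omega) (hext z u h m h3)
  obtain ⟨o1, hV⟩ := hret z u i k h hik oi ok hno
  obtain ⟨o2, hV'⟩ := hret z' u' i' k' h' hik' oi' ok' hno'
  set V := seqFactor u (i + α.length) (k - i).toNat with hVdef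
  set V' := seqFactor u' (i' + α.length) (k' - i').toNat with hVdef'
  have hVl : V.length = (k - i).toNat := length_seqFactor _ _ _
  have hVl' : V'.length = (k' - i').toNat := length_seqFactor _ _ _
  have hne : V ≠ V' := by
    intro heq
    have hlen : k - i = k' - i' := by have := congrArg List.length heq; omega
    refine hb ?_
    rw [← hub, ← hub']
    -- The letter after the first `w` lies in the return word, or in the second `w` when the
    -- occurrences touch or overlap.
    by_cases hd : ((α ++ v ++ β).length : ℤ) < k - i
    · have hoV := (occ_append.mp o1).1
      have hoV' := (occ_append.mp o2).1
      rw [← heq] at hoV'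
      have := hoV.agree hoV' (t := v.length + β.length) (by omega) (by simp at hd; omega)
      simp only [List.length_append, Nat.cast_add]
      rw [show i + ((α.length : ℤ) + v.length + β.length) = i + α.length + (v.length + β.length)
        by ring, this]
      congr 1; ring
    · have := ok.agree ok' (t := (α ++ v ++ β).length - (k - i)) (by omega) (by omega)
      rw [show i + ((α ++ v ++ β).length : ℤ) = k + ((α ++ v ++ β).length - (k - i)) by ring, this,
        hlen]
      congr 1; ring
  have hα : ∀ {u u' : ℤ → A} {i j : ℤ}, Occ u (α ++ v ++ β) i → Occ u' (α ++ v ++ β) j →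
      ∀ t : ℤ, 0 ≤ t → t < α.length → u (i + t) = u' (j + t) := fun a1 a2 t h0 ht =>
    a1.agree a2 h0 (by simp; omega)
  have hsym : (∀ x ∈ T.inducedMap v '' T.inducedPiece v V,
      ∀ y ∈ T.inducedMap v '' T.inducedPiece v V', x < y) ↔
      ∀ x ∈ T.inducedPiece v V', ∀ y ∈ T.inducedPiece v V, x < y := hS ⟨V, hV⟩ ⟨V', hV'⟩
  -- The pieces are compared by `b, b'` and the images, in reverse, by `c, c'`. Symmetry would
  -- contradict `hcross`.
  rw [orderA_inducedPiece_iff hT hV hV' hne h h' o1 o2,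
    orderD_inducedPiece_iff hV' hV hne.symm h' h o2 o1, ← h'.lt_iff_of_agree h (hα oi' oi),
    h'.lt_iff_future h (fun t h0 ht => oi'.agree oi h0 ht) (by rw [hub, hub']; exact hb.symm),
    hub, hub', ← hcross, show i + (α.length : ℤ) + V.length = k + α.length by omega,
    show i' + (α.length : ℤ) + V'.length = k' + α.length by omega,
    ← h.lt_iff_of_agree h' (hα ok ok'), h.lt_iff_past hT h' (m := 0)
      (fun t h0 ht => by simp at ht; omega) (by simpa [huc, huc'] using hc)] at hsym
  simp only [Nat.cast_zero, sub_zero, huc, huc'] at hsym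
  rcases lt_or_gt_of_ne (T.lo_injective.ne hc) with hlt | hlt
  · exact lt_asymm hlt (hsym.mpr hlt)
  · exact lt_asymm hlt (hsym.mp hlt)

end GIET

/-! ### Conclusion -/

theorem mainTheorem5 {A : Type*} [Finite A] (T : GIET A) (hT : T.IsSymmetric)
    (v : List A) (hv : v ∈ T.naturalCoding) :
    ((IsPalindrome v ∨
        ∃ w, IsShortestBispecialContaining T.naturalCoding v w ∧ IsPalindrome w) →
      T.InducedExists v → T.InducedIsSymmetric v) ∧
    (T.IsStandard →
      ∀ w, IsShortestBispecialContaining T.naturalCoding v w → ¬ IsPalindrome w →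
        T.InducedExists v ∧ ¬ T.InducedIsSymmetric v) := by
  refine ⟨?_, fun hS w hw hnp => ⟨hS.inducedExists v, ?_⟩⟩
  · rintro (hp | ⟨w, hw, hp⟩) -
    -- A palindromic `v` plays the role of its own extension.
    · exact GIET.inducedIsSymmetric_of_isPalindrome hT (α := []) (β := []) (by simpa using hp)
        (by simp)
    · obtain ⟨α, β, rfl, hext⟩ := GIET.exists_unique_extension hw
      exact GIET.inducedIsSymmetric_of_isPalindrome hT hp hext
  · obtain ⟨α, β, rfl, hext⟩ := GIET.exists_unique_extension hw
    exact GIET.not_inducedIsSymmetric hT hS.inducedExists hw.1 hnp hext
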